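/- Let $\widetilde W(E_7^{(1)})=W(E_7^{(1)})\rtimes\langle\sigma\rangle$ be the extended affine Weyl group of type $E_7^{(1)}$. Here $W(E_7^{(1)})=\langle s_0,\dots,s_7\rangle$ is the Coxeter group whose diagram is the chain $0-1-3-4-5-6-7$ with the node $2$ attached to the node $4$ (all bonds single), and $\sigma$ is the diagram automorphism $(0\,7)(1\,6)(3\,5)$, so that $\sigma^2=1$ and $\sigma s_i\sigma^{-1}=s_{\sigma(i)}$. The group acts on the real vector space with basis the simple roots $\alpha_0,\dots,\alpha_7$ by $s_j(\alpha_i)=\alpha_i-a_{ij}\alpha_j$, where $(a_{ij})$ is the Cartan matrix of type $E_7^{(1)}$, and $\sigma(\alpha_i)=\alpha_{\sigma(i)}$. Let $\Phi^{(1)}=W(E_7^{(1)})\{\alpha_0,\dots,\alpha_7\}$ be the root system. For a root $\beta=w(\alpha_i)$ with $w\in W(E_7^{(1)})$ put $s_\beta=ws_iw^{-1}$. For a set $S$ of roots let $W_S=\langle s_\beta\mid\beta\in S\rangle$, let $N(W_S)$ be the normalizer of $W_S$ in $\widetilde W(E_7^{(1)})$, and let $N_S=\{w\in\widetilde W(E_7^{(1)})\mid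 wS=S\}$. Write $s_{i\cdots j}=s_i\cdots s_j$ and $\alpha_{i\cdots j}=\alpha_i+\cdots+\alpha_j$ for products and sums over a word of indices. Let $J=\{\alpha_0,\alpha_3,\alpha_5,\alpha_7\}$, $u=s_{5436542}$, and $$b_0=s_{1301},\quad b_1=s_{6576},\quad b_2=s_{4534},\quad b_3=s_2 .$$ **Proposition.** One has $uJ=\{\alpha_0,\alpha_6,\alpha_3,\alpha_{567}\}\subset\Phi^{(1)}$ and $W_{uJ}=\langle s_0,s_6,s_3,s_{76567}\rangle$. The normalizer of $W_{uJ}$ in $\widetilde W(E_7^{(1)})$ is $N(W_{uJ})=u\,N(W_J)\,u^{-1}$, and it is the internal semidirect product $$N(W_{uJ})=W_{uJ}\rtimes N_{uJ},\qquad N_{uJ}=\langle ub_0u^{-1},\,ub_1u^{-1},\,ub_2u^{-1},\,ub_3u^{-1}\rangle\rtimes\langle u\sigma u^{-1}\rangle .$$ Moreover $$N(W_{uJ})\cong W(4A_1)\rtimes\widetilde W(B_3^{(1)}),$$ by an isomorphism under which $s_0,s_6,s_3,s_{76567}$ correspond to the four simple reflections of the Coxeter group $W(4A_1)$, the elements $ub_iu^{-1}$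 $(0\le i\le 3)$ correspond to the simple reflections of the affine Weyl group $W(B_3^{(1)})$, and $u\sigma u^{-1}$ corresponds to the diagram automorphism. Here $\widetilde W(B_3^{(1)})=W(B_3^{(1)})\rtimes\langle\sigma\rangle$, where the diagram of $B_3^{(1)}$ has single bonds $0-2$ and $1-2$ and a double bond $2=3$, and $\sigma$ exchanges the nodes $0$ and $1$. -/

import Mathlib

namespace AffineWeyl

/-! ### Extended Coxeter groups -/

section Extended

variable {B : Type*} (M : CoxeterMatrix B)

/-- The group of diagram automorphisms of the Coxeter diagram of `M`: the permutations of the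
nodes that preserve all the labels. -/
def diagramAut : Subgroup (Equiv.Perm B) where
  carrier := {τ | ∀ i j, M (τ i) (τ j) = M i j}
  one_mem' := by intro i j; rfl
  mul_mem' := by
    intro a b ha hb i j
    exact (ha (b i) (b j)).trans (hb i j)
  inv_mem' := by
    intro a ha i j
    have h := ha (a⁻¹ i) (a⁻¹ j)
    simpa using h.symm

theorem isLiftable_diagram (τ : diagramAut M) :
    M.IsLiftable (fun i => M.simple (τ.1 i)) := by
  intro i j
  have h := M.toCoxeterSystem.simple_mul_simple_pow (τ.1 i) (τ.1 j)
  rw [τ.2 i j] at h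
  exact h

/-- The endomorphism `s_i ↦ s_{τ(i)}` of the Coxeter group of `M`, for a diagram
automorphism `τ`. -/
noncomputable def diagramHom (τ : diagramAut M) : M.Group →* M.Group :=
  M.toCoxeterSystem.lift ⟨fun i => M.simple (τ.1 i), isLiftable_diagram M τ⟩

theorem diagramHom_simple (τ : diagramAut M) (i : B) :
    diagramHom M τ (M.simple i) = M.simple (τ.1 i) :=
  M.toCoxeterSystem.lift_apply_simple (isLiftable_diagram M τ) i

theorem diagramHom_comp (τ τ' : diagramAut M) :
    (diagramHom M τ).comp (diagramHom M τ') = diagramHom M (τ * τ') := by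
  refine M.toCoxeterSystem.ext_simple fun i => ?_
  change diagramHom M τ (diagramHom M τ' (M.simple i)) = diagramHom M (τ * τ') (M.simple i)
  simp only [diagramHom_simple]
  rfl

theorem diagramHom_one : diagramHom M 1 = MonoidHom.id M.Group := by
  refine M.toCoxeterSystem.ext_simple fun i => ?_
  change diagramHom M 1 (M.simple i) = M.simple i
  rw [diagramHom_simple]
  rfl

/-- The action of the diagram automorphisms on the Coxeter group: `τ · s_i = s_{τ(i)}`. -/
noncomputable def diagramAct : diagramAut M →* MulAut M.Group where
  toFun τ := MonoidHom.toMulEquiv (diagramHom M τ) (diagramHom M τ⁻¹)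
    (by rw [diagramHom_comp, inv_mul_cancel, diagramHom_one])
    (by rw [diagramHom_comp, mul_inv_cancel, diagramHom_one])
  map_one' := by
    ext x
    exact DFunLike.congr_fun (diagramHom_one M) x
  map_mul' a b := by
    ext x
    exact (DFunLike.congr_fun (diagramHom_comp M a b) x).symm

/-- The extended Coxeter group `W(M) ⋊ ⟨σ⟩`, where the cyclic group generated by the diagram
automorphism `σ` acts by `σ s_i σ⁻¹ = s_{σ(i)}`. -/
abbrev Ext (σ : diagramAut M) : Type _ :=
  M.Group ⋊[(diagramAct M).comp (Subgroup.zpowers σ).subtype] (Subgroup.zpowers σ)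

/-- The simple reflection `s_i` as an element of the extended group. -/
noncomputable def Ext.s {M : CoxeterMatrix B} (σ : diagramAut M) (i : B) : Ext M σ :=
  SemidirectProduct.inl (M.simple i)

/-- The diagram automorphism `σ` as an element of the extended group. -/
noncomputable def Ext.auto {M : CoxeterMatrix B} (σ : diagramAut M) : Ext M σ :=
  SemidirectProduct.inr ⟨σ, Subgroup.mem_zpowers σ⟩

end Extended

/-! ### The extended affine Weyl group of type `E₇⁽¹⁾` -/

/-- The Coxeter matrix of type `E₇⁽¹⁾`. The diagram is the chain `0 - 1 - 3 - 4 - 5 - 6 - 7`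
together with the node `2` attached to the node `4`. -/
def E7aff : CoxeterMatrix (Fin 8) where
  M := !![1, 3, 2, 2, 2, 2, 2, 2;
          3, 1, 2, 3, 2, 2, 2, 2;
          2, 2, 1, 2, 3, 2, 2, 2;
          2, 3, 2, 1, 3, 2, 2, 2;
          2, 2, 3, 3, 1, 3, 2, 2;
          2, 2, 2, 2, 3, 1, 3, 2;
          2, 2, 2, 2, 2, 3, 1, 3;
          2, 2, 2, 2, 2, 2, 3, 1]
  isSymm := by ext i j; fin_cases i <;> fin_cases j <;> rfl
  diagonal := by intro i; fin_cases i <;> rfl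
  off_diagonal := by intro i j; fin_cases i <;> fin_cases j <;> decide

/-- The generalized Cartan matrix of type `E₇⁽¹⁾`, with rows and columns indexed by `0, …, 7`. -/
def cartanE7 : Matrix (Fin 8) (Fin 8) ℤ :=
  !![ 2, -1,  0,  0,  0,  0,  0,  0;
     -1,  2,  0, -1,  0,  0,  0,  0;
      0,  0,  2,  0, -1,  0,  0,  0;
      0, -1,  0,  2, -1,  0,  0,  0;
      0,  0, -1, -1,  2, -1,  0,  0;
      0,  0,  0,  0, -1,  2, -1,  0;
      0,  0,  0,  0,  0, -1,  2, -1;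
      0,  0,  0,  0,  0,  0, -1,  2]

/-- The diagram automorphism `σ = (0 7)(1 6)(3 5)` of `E₇⁽¹⁾`. -/
def sigmaE7 : diagramAut E7aff :=
  ⟨Equiv.swap 0 7 * Equiv.swap 1 6 * Equiv.swap 3 5, by
    intro i j; fin_cases i <;> fin_cases j <;> decide⟩

/-- The extended affine Weyl group of type `E₇⁽¹⁾`. -/
abbrev WE7 : Type := Ext E7aff sigmaE7

/-- The product of simple reflections `s_{i₁} s_{i₂} ⋯ s_{iₖ}` for a word `[i₁, …, iₖ]`. -/
noncomputable def word (l : List (Fin 8)) : WE7 := (l.map (Ext.s sigmaE7)).prod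

/-! ### The action on the root space -/

/-- The real vector space with basis the simple roots `α₀, …, α₇`. -/
abbrev V : Type := Fin 8 → ℝ

/-- The simple root `α_i`. -/
def α (i : Fin 8) : V := Pi.single i 1

/-- The linear form `v ↦ v · α_j`, determined by `α_i · α_j = a_{ij}`. -/
noncomputable def pairing (j : Fin 8) : V →ₗ[ℝ] ℝ :=
  ∑ i, (cartanE7 i j : ℝ) • LinearMap.proj i

theorem pairing_apply (j : Fin 8) (v : V) : pairing j v = ∑ i, (cartanE7 i j : ℝ) * v i := by
  simp [pairing]

theorem pairing_α (i j : Fin 8) : pairing j (α i) = cartanE7 i j := by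
  simp [pairing_apply, α, Pi.single_apply]

theorem cartanE7_diag (j : Fin 8) : cartanE7 j j = 2 := by
  fin_cases j <;> rfl

theorem pairing_self (j : Fin 8) : pairing j (α j) = 2 := by
  rw [pairing_α, cartanE7_diag]; norm_num

/-- The reflection `v ↦ v - (v · α_j) α_j` along the simple root `α_j`
(recall `α_j · α_j = 2`). -/
noncomputable def refl (j : Fin 8) : V ≃ₗ[ℝ] V := Module.reflection (pairing_self j)

theorem refl_apply (j : Fin 8) (v : V) : refl j v = v - pairing j v • α j :=
  Module.reflection_apply v (pairing_self j)

theorem cartanE7_eq (i j : Fin 8) :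
    cartanE7 i j = if E7aff i j = 1 then 2 else if E7aff i j = 3 then -1 else 0 := by
  fin_cases i <;> fin_cases j <;> decide

theorem cartanE7_symm (i j : Fin 8) : cartanE7 i j = cartanE7 j i := by
  fin_cases i <;> fin_cases j <;> decide

theorem E7aff_cases (i j : Fin 8) :
    i = j ∨ (E7aff i j = 2 ∧ cartanE7 i j = 0) ∨ (E7aff i j = 3 ∧ cartanE7 i j = -1) := by
  fin_cases i <;> fin_cases j <;> decide

theorem isLiftable_refl : E7aff.IsLiftable refl := by
  intro i j
  rcases E7aff_cases i j with rfl | ⟨hm, hc⟩ | ⟨hm, hc⟩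
  · rw [E7aff.diagonal, pow_one]
    ext1 v
    exact Module.involutive_reflection (pairing_self i) v
  · have hc' : cartanE7 j i = 0 := (cartanE7_symm j i).trans hc
    rw [hm]
    refine LinearEquiv.ext fun v => ?_
    simp only [pow_two, LinearEquiv.mul_apply, refl_apply, map_sub, map_smul, pairing_self,
      pairing_α, hc, hc', LinearEquiv.coe_one, id_eq]
    push_cast
    module
  · have hc' : cartanE7 j i = -1 := (cartanE7_symm j i).trans hc
    rw [hm]
    refine LinearEquiv.ext fun v => ?_
    simp only [pow_succ, pow_zero, one_mul, LinearEquiv.mul_apply, refl_apply, map_sub, map_smul,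
      pairing_self, pairing_α, hc, hc', LinearEquiv.coe_one, id_eq]
    push_cast
    module

/-- The reflection action of the affine Weyl group `W(E₇⁽¹⁾)` on the root space. -/
noncomputable def weylRep : E7aff.Group →* (V ≃ₗ[ℝ] V) :=
  E7aff.toCoxeterSystem.lift ⟨refl, isLiftable_refl⟩

theorem weylRep_simple (i : Fin 8) : weylRep (E7aff.simple i) = refl i :=
  E7aff.toCoxeterSystem.lift_apply_simple isLiftable_refl i

/-- The permutation action on the root space: `τ(α_i) = α_{τ(i)}`. -/
noncomputable def permRep : Equiv.Perm (Fin 8) →* (V ≃ₗ[ℝ] V) where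
  toFun τ := LinearEquiv.funCongrLeft ℝ ℝ τ.symm
  map_one' := rfl
  map_mul' _ _ := rfl

theorem permRep_apply (τ : Equiv.Perm (Fin 8)) (v : V) (i : Fin 8) :
    permRep τ v i = v (τ⁻¹ i) := rfl

theorem permRep_α (τ : Equiv.Perm (Fin 8)) (i : Fin 8) : permRep τ (α i) = α (τ i) := by
  funext k
  rw [permRep_apply]
  have h : τ⁻¹ k = i ↔ k = τ i := Equiv.symm_apply_eq τ
  simp only [α, Pi.single_apply, h]

theorem pairing_permRep (τ : diagramAut E7aff) (j : Fin 8) (v : V) :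
    pairing (τ.1 j) (permRep τ.1 v) = pairing j v := by
  rw [pairing_apply, pairing_apply, ← Equiv.sum_comp τ.1]
  refine Finset.sum_congr rfl fun i _ => ?_
  rw [permRep_apply, show τ.1⁻¹ (τ.1 i) = i from τ.1.symm_apply_apply i, cartanE7_eq, τ.2 i j, ← cartanE7_eq]

theorem permRep_refl (τ : diagramAut E7aff) (j : Fin 8) :
    refl (τ.1 j) * permRep τ.1 = permRep τ.1 * refl j := by
  refine LinearEquiv.ext fun v => ?_
  simp only [LinearEquiv.mul_apply, refl_apply, map_sub, map_smul, permRep_α, pairing_permRep]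

/-- The action of the extended affine Weyl group on the root space: `s_j` acts as the reflection
along `α_j`, and `σ` by `σ(α_i) = α_{σ(i)}`. -/
noncomputable def rep : WE7 →* (V ≃ₗ[ℝ] V) :=
  SemidirectProduct.lift weylRep
    ((permRep.comp (diagramAut E7aff).subtype).comp (Subgroup.zpowers sigmaE7).subtype) (by
      intro g
      refine E7aff.toCoxeterSystem.ext_simple fun i => ?_
      change weylRep (diagramHom E7aff g.1 (E7aff.simple i)) =
        permRep g.1.1 * weylRep (E7aff.simple i) * (permRep g.1.1)⁻¹
      rw [diagramHom_simple, weylRep_simple, weylRep_simple, ← permRep_refl, mul_inv_cancel_right])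

theorem rep_s (i : Fin 8) : rep (Ext.s sigmaE7 i) = refl i := by
  rw [rep, Ext.s, SemidirectProduct.lift_inl, weylRep_simple]

theorem rep_auto (i : Fin 8) : rep (Ext.auto sigmaE7) (α i) = α (sigmaE7.1 i) := by
  rw [rep, Ext.auto, SemidirectProduct.lift_inr]
  exact permRep_α _ i

/-- The set of (real) roots `Φ⁽¹⁾ = W(E₇⁽¹⁾) · {α₀, …, α₇}`. -/
def roots : Set V := {β | ∃ (w : E7aff.Group) (i : Fin 8), weylRep w (α i) = β}

/-- The subgroup `W_S` generated by the reflections `s_β`, `β ∈ S`, where the reflection along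
the root `β = w(α_i)` is `s_β = w s_i w⁻¹`. -/
noncomputable def reflSubgroup (S : Set V) : Subgroup WE7 :=
  Subgroup.closure {t | ∃ (w : E7aff.Group) (i : Fin 8), weylRep w (α i) ∈ S ∧
    t = SemidirectProduct.inl (w * E7aff.simple i * w⁻¹)}

/-- The subgroup `N_S` of all the elements `w` of the extended affine Weyl group
with `w S = S`. -/
noncomputable def setStabilizer (S : Set V) : Subgroup WE7 where
  carrier := {w | rep w '' S = S}
  one_mem' := by simp
  mul_mem' := by
    intro a b ha hb
    change rep (a * b) '' S = S
    have h : (rep (a * b) : V → V) = rep a ∘ rep b := by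
      funext v; simp [LinearEquiv.mul_apply]
    rw [h, Set.image_comp, show rep b '' S = S from hb, show rep a '' S = S from ha]
  inv_mem' := by
    intro a ha
    change rep a⁻¹ '' S = S
    have ha' : rep a '' S = S := ha
    conv_lhs => rw [← ha']
    rw [← Set.image_comp]
    simp

/-! ### Types `B₃⁽¹⁾` and `4A₁` -/

/-- The Coxeter matrix of type `B₃⁽¹⁾`: the nodes `0` and `1` are joined to the node `2` by
single bonds, and the node `2` is joined to the node `3` by a double bond. -/
def B3aff : CoxeterMatrix (Fin 4) where
  M := !![1, 2, 3, 2;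
          2, 1, 3, 2;
          3, 3, 1, 4;
          2, 2, 4, 1]
  isSymm := by ext i j; fin_cases i <;> fin_cases j <;> rfl
  diagonal := by intro i; fin_cases i <;> rfl
  off_diagonal := by intro i j; fin_cases i <;> fin_cases j <;> decide

/-- The diagram automorphism `(0 1)` of `B₃⁽¹⁾`. -/
def sigmaB3 : diagramAut B3aff :=
  ⟨Equiv.swap 0 1, by
    intro i j; fin_cases i <;> fin_cases j <;> decide⟩

/-- The extended affine Weyl group of type `B₃⁽¹⁾`. -/
abbrev WB3 : Type := Ext B3aff sigmaB3

/-- The Coxeter matrix of type `4A₁`: four nodes and no bonds. -/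
def fourA1 : CoxeterMatrix (Fin 4) where
  M := !![1, 2, 2, 2;
          2, 1, 2, 2;
          2, 2, 1, 2;
          2, 2, 2, 1]
  isSymm := by ext i j; fin_cases i <;> fin_cases j <;> rfl
  diagonal := by intro i; fin_cases i <;> rfl
  off_diagonal := by intro i j; fin_cases i <;> fin_cases j <;> decide

/-! ### Internal semidirect products and the data of the theorem -/

/-- `K` is the internal semidirect product `N ⋊ H` of its subgroups `N` (normal in `K`)
and `H`. -/
structure IsSemidirect {G : Type*} [Group G] (K N H : Subgroup G) : Prop where
  normal : K ≤ Subgroup.normalizer (N : Set G)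
  disjoint : N ⊓ H = ⊥
  sup_eq : N ⊔ H = K

/-- `J = {α₀, α₃, α₅, α₇}`. -/
def J : Set V := {α 0, α 3, α 5, α 7}

/-- The set `{α₀, α₆, α₃, α₅ + α₆ + α₇}`. -/
def uJ : Set V := {α 0, α 6, α 3, α 5 + α 6 + α 7}

/-- `u = s₅ s₄ s₃ s₆ s₅ s₄ s₂`. -/
noncomputable def u : WE7 := word [5, 4, 3, 6, 5, 4, 2]

/-- The elements `b₀ = s₁s₃s₀s₁`, `b₁ = s₆s₅s₇s₆`, `b₂ = s₄s₅s₃s₄`, `b₃ = s₂`. -/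
noncomputable def b : Fin 4 → WE7 :=
  ![word [1, 3, 0, 1], word [6, 5, 7, 6], word [4, 5, 3, 4], word [2]]

/-- The elements `u b_i u⁻¹`. -/
noncomputable def ub (i : Fin 4) : WE7 := u * b i * u⁻¹

/-- The element `u σ u⁻¹`. -/
noncomputable def uσ : WE7 := u * Ext.auto sigmaE7 * u⁻¹

/-- The generators `s₀, s₆, s₃, s₇s₆s₅s₆s₇`, which are the reflections along
`α₀, α₆, α₃, α₅ + α₆ + α₇`. -/
noncomputable def t : Fin 4 → WE7 := ![word [0], word [6], word [3], word [7, 6, 5, 6, 7]]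

end AffineWeyl

open AffineWeyl

/-! Everything is proved for `J`, where the four roots are simple and mutually orthogonal, and then
carried to `uJ` by conjugation with `u`.

Two facts do most of the work. The first is Tits' lemma (`nonneg_of_not_isRightDescent`): the sign
of `w (a i)` detects whether `i` is a right descent of `w`. It makes `rep` faithful on the extended
group (`rep_injective`), so every relation among the `b i`, `σ` and the reflections becomes an
identity of linear maps, checked on a generic vector. Applied to other families of nonnegative
vectors, the same lemma shows that `W(4A₁)` and `W(B₃⁽¹⁾)` embed: the `b i` act on the orthogonal
vectors `bRoot i` by a Cartan matrix of type `B₃⁽¹⁾`, which leaves no room for further relations.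
The second is that an element of the root-space image is a reflection along at most one line, so
conjugation of reflections is read off from the action on roots.

Normalizer: an element normalizing `W_J` sends each root of `J` to plus or minus a root of `J`,
because the only reflections in the elementary abelian group `W_J` are the four obvious ones
(`eq_or_eq_neg_of_isReflAlong`). An element of `W_J` corrects the signs and leaves an element
stabilizing `J`. The product is direct as a set because a nontrivial element of `W_J` negates some
root of `J`.

Stabilizer: up to a power of `σ` its elements lie in `W(E₇⁽¹⁾)`. If such a `w` is not trivial, it
has a descent `i` outside `J`, and multiplying by the matching `b` shortens it (`length_mul_lt`), so
induction on length shows that the `b i` generate (`inl_mem_closure_b`). -/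

namespace CoxeterSystem

/-! ### Signs of roots and right descents -/

section Tits

variable {B W V : Type*} [Group W] {M : CoxeterMatrix B} (cs : CoxeterSystem M W)
  [AddCommGroup V] [PartialOrder V] [IsOrderedAddMonoid V] [Module ℝ V]

/-- Tits' lemma for a reflection representation given by vectors `a i` in an ordered vector space,
when all the bonds of the Coxeter diagram are labelled `3` or `4`: if `ℓ (w * s i) > ℓ w`, then
`w (a i)` is nonnegative. -/
theorem nonneg_of_not_isRightDescent [PosSMulMono ℝ V] (ρ : W →* (V ≃ₗ[ℝ] V)) (a : B → V) (c : B → B → ℝ)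
    (ha : ∀ i, 0 ≤ a i) (hself : ∀ i, ρ (cs.simple i) (a i) = -a i)
    (hrefl : ∀ i j, i ≠ j → ρ (cs.simple j) (a i) = a i + c i j • a j)
    (hc : ∀ i j, i ≠ j → (M i j = 2 ∧ c i j = 0) ∨ (M i j = 3 ∧ c i j = 1 ∧ c j i = 1) ∨
      (M i j = 4 ∧ 0 ≤ c i j ∧ c i j * c j i = 2)) (w : W) (i : B)
    (hw : ¬ cs.IsRightDescent w i) : 0 ≤ ρ w (a i) := by
  induction hn : cs.length w using Nat.strong_induction_on generalizing w i with
  | _ n ih =>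
  subst hn
  have ih' : ∀ v k, cs.length v < cs.length w → ¬ cs.IsRightDescent v k → 0 ≤ ρ v (a k) :=
    fun v k hv hk => ih _ hv v k hk rfl
  by_cases hw1 : w = 1
  · simpa [hw1] using ha i
  obtain ⟨j, hj⟩ := cs.exists_rightDescent_of_ne_one hw1
  have hij : i ≠ j := fun h => hw (h ▸ hj)
  have hwi := cs.not_isRightDescent_iff.1 hw
  have hwj := cs.isRightDescent_iff.1 hj
  have hinv : (cs.simple i * cs.simple j)⁻¹ = cs.simple j * cs.simple i := by
    rw [mul_inv_rev, inv_simple, inv_simple]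
  have hpow := cs.simple_mul_simple_pow i j
  -- From here the dihedral part of `w` in `s i`, `s j` is peeled off one letter at a time. A
  -- further descent at every stage would let the braid relation rewrite `w * s i` as a word too
  -- short for its length, so peeling stops in time.
  obtain ⟨v, rfl⟩ : ∃ v, w = v * cs.simple j := ⟨w * cs.simple j, by simp⟩
  rw [simple_mul_simple_cancel_right] at hwj
  have hvj : 0 ≤ ρ v (a j) := ih' v j (by omega) (cs.not_isRightDescent_iff.2 (by omega))
  have ew : ρ (v * cs.simple j) (a i) = ρ v (a i) + c i j • ρ v (a j) := by
    rw [map_mul, LinearEquiv.mul_apply, hrefl i j hij, map_add, map_smul]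
  rcases hc i j hij with ⟨hm, hcij⟩ | ⟨hm, hcij, hcji⟩ | ⟨hm, hcij, hcc⟩
  · rw [ew, hcij, zero_smul, add_zero]
    refine ih' v i (by omega) fun hvi => ?_
    have e : v * cs.simple j * cs.simple i = v * cs.simple i * cs.simple j := by
      rw [hm] at hpow
      rw [mul_assoc, mul_assoc, ← hinv, inv_eq_iff_mul_eq_one.2 (by rw [← pow_two, hpow])]
    have h1 := cs.isRightDescent_iff.1 hvi
    rw [e] at hwi
    have h2 := cs.length_mul_simple (v * cs.simple i) j
    omega
  · rw [ew, hcij, one_smul]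
    by_cases hvi : cs.IsRightDescent v i
    · obtain ⟨x, rfl⟩ : ∃ x, v = x * cs.simple i := ⟨v * cs.simple i, by simp⟩
      have hxi := cs.isRightDescent_iff.1 hvi
      rw [simple_mul_simple_cancel_right] at hxi
      have e1 : ρ (x * cs.simple i) (a i) + ρ (x * cs.simple i) (a j) = ρ x (a j) := by
        simp only [map_mul, LinearEquiv.mul_apply, hself, hrefl j i hij.symm, hcji, map_add,
          map_neg, one_smul]
        abel
      rw [e1]
      refine ih' x j (by omega) fun hxj => ?_
      have h1 := cs.isRightDescent_iff.1 hxj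
      have e : x * cs.simple i * cs.simple j * cs.simple i =
          x * cs.simple j * cs.simple i * cs.simple j := by
        rw [hm] at hpow
        have h3 : cs.simple j * cs.simple i * cs.simple j * cs.simple i
            = cs.simple i * cs.simple j := by
          rw [mul_assoc _ (cs.simple j), ← hinv, ← mul_inv_rev, inv_eq_iff_mul_eq_one, ← hpow]
          simp only [pow_succ, pow_zero, one_mul]
        have h4 : cs.simple i * cs.simple j * cs.simple i =
            cs.simple j * cs.simple i * cs.simple j := by
          rw [← h3, simple_mul_simple_cancel_right]
        simp only [mul_assoc] at h4 ⊢
        rw [h4]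
      rw [e] at hwi
      have h2 := cs.length_mul_simple (x * cs.simple j) i
      have h3 := cs.length_mul_simple (x * cs.simple j * cs.simple i) j
      omega
    · exact add_nonneg (ih' v i (by omega) hvi) hvj
  · rw [ew]
    by_cases hvi : cs.IsRightDescent v i
    · obtain ⟨x, rfl⟩ : ∃ x, v = x * cs.simple i := ⟨v * cs.simple i, by simp⟩
      have hxi := cs.isRightDescent_iff.1 hvi
      rw [simple_mul_simple_cancel_right] at hxi
      -- Since `c i j * c j i = 2`, the coefficient of `a i` is `-1 + 2 = 1`: the combination `a i +
      -- c i j • a j` is fixed by `s i`.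
      have e1 : ρ (x * cs.simple i) (a i) + c i j • ρ (x * cs.simple i) (a j) =
          ρ x (a i) + c i j • ρ x (a j) := by
        simp only [map_mul, LinearEquiv.mul_apply, hself, hrefl j i hij.symm, map_add,
          map_neg, map_smul, smul_add, smul_smul, hcc]
        module
      rw [e1]
      have hxi' : 0 ≤ ρ x (a i) := ih' x i (by omega) (cs.not_isRightDescent_iff.2 (by omega))
      by_cases hxj : cs.IsRightDescent x j
      · obtain ⟨y, rfl⟩ : ∃ y, x = y * cs.simple j := ⟨x * cs.simple j, by simp⟩
        have hyj := cs.isRightDescent_iff.1 hxj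
        rw [simple_mul_simple_cancel_right] at hyj
        have e2 : ρ (y * cs.simple j) (a i) + c i j • ρ (y * cs.simple j) (a j) = ρ y (a i) := by
          simp only [map_mul, LinearEquiv.mul_apply, hself, hrefl i j hij, map_add,
            map_neg, map_smul]
          module
        rw [e2]
        refine ih' y i (by omega) fun hyi => ?_
        have h1 := cs.isRightDescent_iff.1 hyi
        have e : y * cs.simple j * cs.simple i * cs.simple j * cs.simple i =
            y * cs.simple i * cs.simple j * cs.simple i * cs.simple j := by
          rw [hm] at hpow
          have h4 : cs.simple j * cs.simple i * cs.simple j * cs.simple i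
              = cs.simple i * cs.simple j * cs.simple i * cs.simple j := by
            rw [mul_assoc _ (cs.simple j), ← hinv, ← mul_inv_rev, inv_eq_iff_mul_eq_one, ← hpow]
            simp only [pow_succ, pow_zero, one_mul, mul_assoc]
          simp only [mul_assoc] at h4 ⊢
          rw [h4]
        rw [e] at hwi
        have h2 := cs.length_mul_simple (y * cs.simple i) j
        have h3 := cs.length_mul_simple (y * cs.simple i * cs.simple j) i
        have h4 := cs.length_mul_simple (y * cs.simple i * cs.simple j * cs.simple i) j
        omega
      · exact add_nonneg hxi' (smul_nonneg hcij (ih' x j (by omega) hxj))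
    · exact add_nonneg (ih' v i (by omega) hvi) (smul_nonneg hcij hvj)

/-- If `ℓ (w * s i) < ℓ w`, then `w (a i)` is nonpositive. -/
theorem nonpos_of_isRightDescent (ρ : W →* (V ≃ₗ[ℝ] V)) (a : B → V)
    (hself : ∀ i, ρ (cs.simple i) (a i) = -a i)
    (h : ∀ w i, ¬ cs.IsRightDescent w i → 0 ≤ ρ w (a i)) (w : W) (i : B)
    (hw : cs.IsRightDescent w i) : ρ w (a i) ≤ 0 := by
  have h1 := h (w * cs.simple i) i (cs.isRightDescent_iff_not_isRightDescent_mul.1 hw)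
  rwa [map_mul, LinearEquiv.mul_apply, hself, map_neg, neg_nonneg] at h1

/-- An element that keeps all the `a i` nonnegative is trivial. -/
theorem eq_one_of_nonneg (ρ : W →* (V ≃ₗ[ℝ] V)) (a : B → V) (ha : ∀ i, a i ≠ 0)
    (hself : ∀ i, ρ (cs.simple i) (a i) = -a i)
    (h : ∀ w i, ¬ cs.IsRightDescent w i → 0 ≤ ρ w (a i)) (w : W)
    (hw : ∀ i, 0 ≤ ρ w (a i)) : w = 1 := by
  by_contra hw1
  obtain ⟨i, hi⟩ := cs.exists_rightDescent_of_ne_one hw1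
  have h0 := le_antisymm (cs.nonpos_of_isRightDescent ρ a hself h w i hi) (hw i)
  exact ha i ((map_eq_zero_iff _ (ρ w).injective).1 h0)

end Tits

end CoxeterSystem

/-! ### From internal to external semidirect products -/

namespace SemidirectProduct

/-- Two injective homomorphisms whose ranges form an internal semidirect product identify it with
an external semidirect product. -/
theorem exists_mulEquiv_of_injective {N H G : Type*} [Group N] [Group H] [Group G]
    (A : N →* G) (C : H →* G) (hA : Function.Injective A) (hC : Function.Injective C)
    (K : Subgroup G) (hnorm : K ≤ Subgroup.normalizer (A.range : Set G))
    (hdisj : A.range ⊓ C.range = ⊥) (hsup : A.range ⊔ C.range = K) :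
    ∃ (φ : H →* MulAut N) (e : (N ⋊[φ] H) ≃* K),
      (∀ n, ((e (inl n) : K) : G) = A n) ∧ ∀ h, ((e (inr h) : K) : G) = C h := by
  have hCn : ∀ h, C h ∈ Subgroup.normalizer (A.range : Set G) := fun h =>
    hnorm (hsup ▸ Subgroup.mem_sup_right ⟨h, rfl⟩)
  -- The action is forced: conjugation by `C h` on the range of `A`, pulled back along the injection
  -- `A`.
  let φ : H →* MulAut N :=
    (MulAut.congr (MonoidHom.ofInjective hA).symm).toMonoidHom.comp
      (A.range.normalizerMonoidHom.comp (C.codRestrict _ hCn))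
  have hφ : ∀ h n, A (φ h n) = C h * A n * (C h)⁻¹ := by
    intro h n
    change A ((MonoidHom.ofInjective hA).symm _) = _
    rw [MonoidHom.apply_ofInjective_symm]
    rfl
  have hcomp : ∀ h, A.comp (φ h).toMonoidHom = (MulAut.conj (C h)).toMonoidHom.comp A :=
    fun h => MonoidHom.ext (hφ h)
  let L : N ⋊[φ] H →* G := lift A C hcomp
  have hL : ∀ x, L x = A x.left * C x.right := fun x => rfl
  have hLinj : Function.Injective L := by
    rw [injective_iff_map_eq_one]
    intro x hx
    rw [hL] at hx
    have h1 : A x.left ∈ A.range ⊓ C.range :=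
      ⟨⟨_, rfl⟩, ⟨x.right⁻¹, by rw [map_inv, ← eq_inv_of_mul_eq_one_left hx]⟩⟩
    rw [hdisj, Subgroup.mem_bot] at h1
    rw [h1, one_mul] at hx
    ext
    · exact hA (h1.trans A.map_one.symm)
    · exact hC (hx.trans C.map_one.symm)
  have hLK : L.range = K := by
    apply le_antisymm
    · rintro _ ⟨x, rfl⟩
      rw [← hsup, hL]
      exact mul_mem (Subgroup.mem_sup_left ⟨_, rfl⟩) (Subgroup.mem_sup_right ⟨_, rfl⟩)
    · rw [← hsup, sup_le_iff]
      constructor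
      · rintro _ ⟨n, rfl⟩
        exact ⟨inl n, lift_inl _ _ _ n⟩
      · rintro _ ⟨n, rfl⟩
        exact ⟨inr n, lift_inr _ _ _ n⟩
  refine ⟨φ, (MonoidHom.ofInjective hLinj).trans (MulEquiv.subgroupCongr hLK), fun n => ?_,
    fun h => ?_⟩
  · exact lift_inl A C hcomp n
  · exact lift_inr A C hcomp h

end SemidirectProduct

namespace AffineWeyl

/-! ### The reflection representation of the extended affine Weyl group -/

theorem refl_vec0 (a b c d e f g h : ℝ) :
    refl 0 ![a, b, c, d, e, f, g, h] = ![b - a, b, c, d, e, f, g, h] := by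
  rw [refl_apply, pairing_apply]
  ext k
  fin_cases k <;> simp [Fin.sum_univ_succ, cartanE7, α]
  ring

theorem refl_vec1 (a b c d e f g h : ℝ) :
    refl 1 ![a, b, c, d, e, f, g, h] = ![a, a + d - b, c, d, e, f, g, h] := by
  rw [refl_apply, pairing_apply]
  ext k
  fin_cases k <;> simp [Fin.sum_univ_succ, cartanE7, α]
  ring

theorem refl_vec2 (a b c d e f g h : ℝ) :
    refl 2 ![a, b, c, d, e, f, g, h] = ![a, b, e - c, d, e, f, g, h] := by
  rw [refl_apply, pairing_apply]
  ext k
  fin_cases k <;> simp [Fin.sum_univ_succ, cartanE7, α]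
  ring

theorem refl_vec3 (a b c d e f g h : ℝ) :
    refl 3 ![a, b, c, d, e, f, g, h] = ![a, b, c, b + e - d, e, f, g, h] := by
  rw [refl_apply, pairing_apply]
  ext k
  fin_cases k <;> simp [Fin.sum_univ_succ, cartanE7, α]
  ring

theorem refl_vec4 (a b c d e f g h : ℝ) :
    refl 4 ![a, b, c, d, e, f, g, h] = ![a, b, c, d, c + d + f - e, f, g, h] := by
  rw [refl_apply, pairing_apply]
  ext k
  fin_cases k <;> simp [Fin.sum_univ_succ, cartanE7, α]
  ring

theorem refl_vec5 (a b c d e f g h : ℝ) :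
    refl 5 ![a, b, c, d, e, f, g, h] = ![a, b, c, d, e, e + g - f, g, h] := by
  rw [refl_apply, pairing_apply]
  ext k
  fin_cases k <;> simp [Fin.sum_univ_succ, cartanE7, α]
  ring

theorem refl_vec6 (a b c d e f g h : ℝ) :
    refl 6 ![a, b, c, d, e, f, g, h] = ![a, b, c, d, e, f, f + h - g, h] := by
  rw [refl_apply, pairing_apply]
  ext k
  fin_cases k <;> simp [Fin.sum_univ_succ, cartanE7, α]
  ring

theorem refl_vec7 (a b c d e f g h : ℝ) :
    refl 7 ![a, b, c, d, e, f, g, h] = ![a, b, c, d, e, f, g, g - h] := by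
  rw [refl_apply, pairing_apply]
  ext k
  fin_cases k <;> simp [Fin.sum_univ_succ, cartanE7, α]
  ring

theorem refl_α (i j : Fin 8) : refl j (α i) = α i + (-(cartanE7 i j : ℝ)) • α j := by
  rw [refl_apply, pairing_α]
  module

theorem refl_α_self (i : Fin 8) : refl i (α i) = -α i := by
  rw [refl_apply, pairing_self]
  module

theorem α_nonneg (i : Fin 8) : 0 ≤ α i := Pi.single_nonneg.2 zero_le_one

theorem α_ne_zero (i : Fin 8) : α i ≠ 0 := by simp [α]

theorem α_injective : Function.Injective α := fun i j h => by
  by_contra hij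
  have := congrFun h i
  simp [α, hij] at this

theorem weylRep_α_nonneg (w : E7aff.Group) (i : Fin 8)
    (hw : ¬ E7aff.toCoxeterSystem.IsRightDescent w i) : 0 ≤ weylRep w (α i) := by
  refine E7aff.toCoxeterSystem.nonneg_of_not_isRightDescent weylRep α
    (fun i j => -(cartanE7 i j : ℝ)) α_nonneg (fun i => ?_) (fun i j _ => ?_)
    (fun i j hij => ?_) w i hw
  · exact (congrArg (· (α i)) (weylRep_simple i)).trans (refl_α_self i)
  · exact (congrArg (· (α i)) (weylRep_simple j)).trans (refl_α i j)
  · rcases E7aff_cases i j with h | ⟨hm, h⟩ | ⟨hm, h⟩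
    · exact absurd h hij
    · simp [hm, h]
    · simp [hm, h, cartanE7_symm j i]

theorem weylRep_α_nonpos (w : E7aff.Group) (i : Fin 8)
    (hw : E7aff.toCoxeterSystem.IsRightDescent w i) : weylRep w (α i) ≤ 0 :=
  E7aff.toCoxeterSystem.nonpos_of_isRightDescent weylRep α
    (fun i => (congrArg (· (α i)) (weylRep_simple i)).trans (refl_α_self i)) weylRep_α_nonneg w i hw

theorem eq_one_of_weylRep_nonneg (w : E7aff.Group) (hw : ∀ i, 0 ≤ weylRep w (α i)) : w = 1 :=
  E7aff.toCoxeterSystem.eq_one_of_nonneg weylRep α α_ne_zero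
    (fun i => (congrArg (· (α i)) (weylRep_simple i)).trans (refl_α_self i)) weylRep_α_nonneg w hw

theorem rep_inl (w : E7aff.Group) : rep (SemidirectProduct.inl w) = weylRep w := by
  rw [rep, SemidirectProduct.lift_inl]

theorem rep_inr (τ : Subgroup.zpowers sigmaE7) :
    rep (SemidirectProduct.inr τ) = permRep τ.1.1 := by
  rw [rep, SemidirectProduct.lift_inr]
  rfl

theorem rep_apply (g : WE7) (v : V) : rep g v = weylRep g.left (permRep g.right.1.1 v) := by
  rw [← rep_inl, ← rep_inr, ← LinearEquiv.mul_apply, ← map_mul,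
    SemidirectProduct.inl_left_mul_inr_right]

/-- If `g` acts trivially, its Coxeter part permutes the simple roots, hence keeps them positive and
is trivial by Tits' lemma. The remaining diagram permutation fixes every simple root. -/
theorem rep_injective : Function.Injective rep := by
  rw [injective_iff_map_eq_one]
  intro g hg
  have h : ∀ i, weylRep g.left (α (g.right.1.1 i)) = α i := fun i => by
    rw [← permRep_α, ← rep_apply, hg]
    rfl
  have h1 : g.left = 1 := eq_one_of_weylRep_nonneg _ fun i => by
    obtain ⟨j, rfl⟩ := g.right.1.1.surjective i
    rw [h]
    exact α_nonneg j
  refine SemidirectProduct.ext h1 (Subtype.ext (Subtype.ext (Equiv.ext fun i => ?_)))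
  have h2 := h i
  rw [h1, map_one] at h2
  exact α_injective h2

/-! ### The invariant form and reflections -/

/-- The invariant symmetric bilinear form with `α_i · α_j = a_{ij}`. -/
noncomputable def form : LinearMap.BilinForm ℝ V :=
  Matrix.toBilin' (cartanE7.map (Int.cast : ℤ → ℝ))

theorem form_α_α (i j : Fin 8) : form (α i) (α j) = cartanE7 i j := by
  rw [form, α, α, Matrix.toBilin'_single]
  rfl

theorem pi_basisFun_eq_α (i : Fin 8) : Pi.basisFun ℝ (Fin 8) i = α i := Pi.basisFun_apply _ _ _

theorem form_symm (v w : V) : form v w = form w v := by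
  have h : form = LinearMap.flip form := (Pi.basisFun ℝ (Fin 8)).ext fun i =>
    (Pi.basisFun ℝ (Fin 8)).ext fun j => by
      rw [LinearMap.flip_apply]
      simp only [pi_basisFun_eq_α, form_α_α]
      rw [cartanE7_symm]
  exact LinearMap.congr_fun₂ h v w

theorem form_α_right (v : V) (j : Fin 8) : form v (α j) = pairing j v := by
  have h : LinearMap.flip form (α j) = pairing j := (Pi.basisFun ℝ (Fin 8)).ext fun i => by
    rw [pi_basisFun_eq_α, LinearMap.flip_apply, form_α_α, pairing_α]
  exact LinearMap.congr_fun h v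

theorem form_refl (j : Fin 8) (v w : V) : form (refl j v) (refl j w) = form v w := by
  simp only [refl_apply, map_sub, map_smul, LinearMap.sub_apply, LinearMap.smul_apply,
    form_α_right, form_symm (α j), pairing_self, smul_eq_mul]
  ring

theorem form_permRep (τ : diagramAut E7aff) (v w : V) :
    form (permRep τ.1 v) (permRep τ.1 w) = form v w := by
  have h : form.compl₁₂ (permRep τ.1).toLinearMap (permRep τ.1).toLinearMap = form :=
    (Pi.basisFun ℝ (Fin 8)).ext fun i => (Pi.basisFun ℝ (Fin 8)).ext fun j => by
      rw [pi_basisFun_eq_α, pi_basisFun_eq_α, LinearMap.compl₁₂_apply, LinearEquiv.coe_coe,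
        permRep_α, permRep_α, form_α_α, form_α_α, cartanE7_eq, cartanE7_eq, τ.2]
  exact LinearMap.congr_fun₂ h v w

theorem form_weylRep (g : E7aff.Group) (v w : V) :
    form (weylRep g v) (weylRep g w) = form v w := by
  induction g using E7aff.toCoxeterSystem.simple_induction_left generalizing v w with
  | one => simp
  | mul_simple_left g i ih =>
    have h : ∀ x, weylRep (E7aff.toCoxeterSystem.simple i * g) x = refl i (weylRep g x) := by
      intro x
      rw [map_mul, ← weylRep_simple]
      rfl
    rw [h, h, form_refl, ih]

theorem form_rep (g : WE7) (v w : V) : form (rep g v) (rep g w) = form v w := by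
  rw [rep_apply, rep_apply, form_weylRep, form_permRep]

/-- `t` acts on the root space as the reflection along `β`. -/
def IsReflAlong (t : WE7) (β : V) : Prop := ∀ v, rep t v = v - form v β • β

/-- By faithfulness a reflection is determined by its root. This turns identities between conjugates
in the group into identities between vectors. -/
theorem IsReflAlong.eq {t t' : WE7} {β : V} (h : IsReflAlong t β) (h' : IsReflAlong t' β) :
    t = t' :=
  rep_injective (LinearEquiv.ext fun v => (h v).trans (h' v).symm)

theorem IsReflAlong.conj {t : WE7} {β : V} (h : IsReflAlong t β) (g : WE7) :
    IsReflAlong (g * t * g⁻¹) (rep g β) := by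
  intro v
  obtain ⟨v, rfl⟩ := (rep g).surjective v
  rw [form_rep, map_mul, map_mul, LinearEquiv.mul_apply, LinearEquiv.mul_apply,
    ← LinearEquiv.mul_apply (rep g⁻¹), ← map_mul, inv_mul_cancel, map_one, LinearEquiv.coe_one,
    id_eq, h, map_sub, map_smul]

theorem isReflAlong_s (i : Fin 8) : IsReflAlong (Ext.s sigmaE7 i) (α i) := by
  intro v
  rw [rep_s, refl_apply, form_α_right]

theorem isReflAlong_inl (w : E7aff.Group) (i : Fin 8) :
    IsReflAlong (SemidirectProduct.inl (w * E7aff.simple i * w⁻¹)) (weylRep w (α i)) := by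
  rw [map_mul, map_mul, map_inv, ← rep_inl]
  exact (isReflAlong_s i).conj _

/-- A root may be written as `w (α i)` in many ways, but all of them give the same reflection, so
one chosen reflection per root generates. -/
theorem reflSubgroup_range {ι : Type*} {β : ι → V} {t : ι → WE7} (hβ : ∀ k, β k ∈ roots)
    (ht : ∀ k, IsReflAlong (t k) (β k)) :
    reflSubgroup (Set.range β) = Subgroup.closure (Set.range t) := by
  apply le_antisymm
  · rw [reflSubgroup, Subgroup.closure_le]
    rintro _ ⟨w, i, ⟨k, hk⟩, rfl⟩
    exact Subgroup.subset_closure ⟨k, (ht k).eq (hk ▸ isReflAlong_inl w i)⟩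
  · rw [Subgroup.closure_le]
    rintro _ ⟨k, rfl⟩
    obtain ⟨w, i, h⟩ := hβ k
    exact Subgroup.subset_closure ⟨w, i, ⟨k, h.symm⟩, (ht k).eq (h ▸ isReflAlong_inl w i)⟩

theorem exists_word_eq_inl (l : List (Fin 8)) : ∃ w, word l = SemidirectProduct.inl w := by
  induction l with
  | nil => exact ⟨1, by simp [word]⟩
  | cons i l ih =>
    obtain ⟨w, hw⟩ := ih
    refine ⟨E7aff.simple i * w, ?_⟩
    rw [map_mul, ← hw]
    simp [word, Ext.s]

theorem rep_word_mem_roots (l : List (Fin 8)) (i : Fin 8) : rep (word l) (α i) ∈ roots := by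
  obtain ⟨w, hw⟩ := exists_word_eq_inl l
  rw [hw, rep_inl]
  exact ⟨w, i, rfl⟩

theorem rep_word_nil (v : V) : rep (word []) v = v := by simp [word]

theorem rep_word_cons (i : Fin 8) (l : List (Fin 8)) (v : V) :
    rep (word (i :: l)) v = refl i (rep (word l) v) := by
  rw [← rep_s, ← LinearEquiv.mul_apply, ← map_mul]
  simp [word]

/-! ### The elements `b_i` -/

theorem vec_ext {a b c d e f g h a' b' c' d' e' f' g' h' : ℝ} (ha : a = a') (hb : b = b')
    (hc : c = c') (hd : d = d') (he : e = e') (hf : f = f') (hg : g = g') (hh : h = h') :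
    ![a, b, c, d, e, f, g, h] = ![a', b', c', d', e', f', g', h'] := by
  rw [ha, hb, hc, hd, he, hf, hg, hh]

theorem rep_b0 (a b' c d e f g h : ℝ) :
    rep (b 0) ![a, b', c, d, e, f, g, h] =
      ![-b' + d, -b' + e, c, a - b' + e, e, f, g, h] := by
  rw [show b 0 = word [1, 3, 0, 1] from rfl]
  simp only [rep_word_cons, rep_word_nil]
  rw [refl_vec1, refl_vec0, refl_vec3, refl_vec1]
  apply vec_ext <;> ring

theorem rep_b1 (a b' c d e f g h : ℝ) :
    rep (b 1) ![a, b', c, d, e, f, g, h] =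
      ![a, b', c, d, e, e - g + h, e - g, f - g] := by
  rw [show b 1 = word [6, 5, 7, 6] from rfl]
  simp only [rep_word_cons, rep_word_nil]
  rw [refl_vec6, refl_vec7, refl_vec5, refl_vec6]
  apply vec_ext <;> ring

theorem rep_b2 (a b' c d e f g h : ℝ) :
    rep (b 2) ![a, b', c, d, e, f, g, h] =
      ![a, b', c, b' + c - e + f, b' + 2 * c - e + g, c + d - e + g, g, h] := by
  rw [show b 2 = word [4, 5, 3, 4] from rfl]
  simp only [rep_word_cons, rep_word_nil]
  rw [refl_vec4, refl_vec3, refl_vec5, refl_vec4]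
  apply vec_ext <;> ring

theorem rep_b3 (a b' c d e f g h : ℝ) :
    rep (b 3) ![a, b', c, d, e, f, g, h] =
      ![a, b', -c + e, d, e, f, g, h] := by
  rw [show b 3 = word [2] from rfl]
  simp only [rep_word_cons, rep_word_nil]
  rw [refl_vec2]
  apply vec_ext <;> ring

theorem rep_auto_vec (a b c d e f g h : ℝ) :
    rep (Ext.auto sigmaE7) ![a, b, c, d, e, f, g, h] = ![h, g, c, f, e, d, b, a] := by
  rw [Ext.auto, rep_inr]
  ext k
  have hk : sigmaE7.1⁻¹ k = ![7, 6, 2, 5, 4, 3, 1, 0] k := by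
    revert k
    decide
  rw [permRep_apply, hk]
  fin_cases k <;> simp

/-- Faithfulness in coordinates: a word in the group is trivial once it fixes a vector with
indeterminate entries, which `ring` can verify. -/
theorem eq_one_of_rep_vec {g : WE7}
    (h : ∀ a b c d e f g' h : ℝ, rep g ![a, b, c, d, e, f, g', h] = ![a, b, c, d, e, f, g', h]) :
    g = 1 := by
  refine rep_injective (LinearEquiv.ext fun v => ?_)
  have hv : v = ![v 0, v 1, v 2, v 3, v 4, v 5, v 6, v 7] := by
    ext k
    fin_cases k <;> rfl
  rw [hv, h, map_one]
  rfl

theorem b_mul_self (i : Fin 4) : b i * b i = 1 := by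
  refine eq_one_of_rep_vec fun _ _ _ _ _ _ _ _ => ?_
  rw [map_mul, LinearEquiv.mul_apply]
  match i with
  | 0 => rw [rep_b0, rep_b0]; apply vec_ext <;> ring
  | 1 => rw [rep_b1, rep_b1]; apply vec_ext <;> ring
  | 2 => rw [rep_b2, rep_b2]; apply vec_ext <;> ring
  | 3 => rw [rep_b3, rep_b3]; apply vec_ext <;> ring

theorem b_mul_pow01 : (b 0 * b 1) ^ 2 = 1 := by
  refine eq_one_of_rep_vec fun _ _ _ _ _ _ _ _ => ?_
  simp only [map_mul, pow_succ, pow_zero, one_mul, LinearEquiv.mul_apply]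
  iterate 2 rw [rep_b1, rep_b0]
  apply vec_ext <;> ring

theorem b_mul_pow02 : (b 0 * b 2) ^ 3 = 1 := by
  refine eq_one_of_rep_vec fun _ _ _ _ _ _ _ _ => ?_
  simp only [map_mul, pow_succ, pow_zero, one_mul, LinearEquiv.mul_apply]
  iterate 3 rw [rep_b2, rep_b0]
  apply vec_ext <;> ring

theorem b_mul_pow12 : (b 1 * b 2) ^ 3 = 1 := by
  refine eq_one_of_rep_vec fun _ _ _ _ _ _ _ _ => ?_
  simp only [map_mul, pow_succ, pow_zero, one_mul, LinearEquiv.mul_apply]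
  iterate 3 rw [rep_b2, rep_b1]
  apply vec_ext <;> ring

theorem b_mul_pow03 : (b 0 * b 3) ^ 2 = 1 := by
  refine eq_one_of_rep_vec fun _ _ _ _ _ _ _ _ => ?_
  simp only [map_mul, pow_succ, pow_zero, one_mul, LinearEquiv.mul_apply]
  iterate 2 rw [rep_b3, rep_b0]
  apply vec_ext <;> ring

theorem b_mul_pow13 : (b 1 * b 3) ^ 2 = 1 := by
  refine eq_one_of_rep_vec fun _ _ _ _ _ _ _ _ => ?_
  simp only [map_mul, pow_succ, pow_zero, one_mul, LinearEquiv.mul_apply]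
  iterate 2 rw [rep_b3, rep_b1]
  apply vec_ext <;> ring

theorem b_mul_pow23 : (b 2 * b 3) ^ 4 = 1 := by
  refine eq_one_of_rep_vec fun _ _ _ _ _ _ _ _ => ?_
  simp only [map_mul, pow_succ, pow_zero, one_mul, LinearEquiv.mul_apply]
  iterate 4 rw [rep_b3, rep_b2]
  apply vec_ext <;> ring

/-! ### The embedding of the affine Weyl group of type `B₃⁽¹⁾` -/

theorem isLiftable_b : B3aff.IsLiftable b := by
  intro i j
  wlog hij : i ≤ j generalizing i j
  · have h := this j i (le_of_not_ge hij)
    rw [B3aff.symmetric, ← inv_inj, ← inv_pow, mul_inv_rev,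
      inv_eq_of_mul_eq_one_left (b_mul_self i), inv_eq_of_mul_eq_one_left (b_mul_self j), h, inv_one]
  rcases hij.eq_or_lt with rfl | hij
  · rw [B3aff.diagonal, pow_one, b_mul_self]
  fin_cases i <;> fin_cases j <;> first | exact absurd hij (by decide) | skip
  exacts [b_mul_pow01, b_mul_pow02, b_mul_pow03, b_mul_pow12, b_mul_pow13, b_mul_pow23]

/-- The homomorphism `W(B₃⁽¹⁾) → W̃(E₇⁽¹⁾)`, `s_i ↦ b_i`. -/
noncomputable def bHom : B3aff.Group →* WE7 := B3aff.toCoxeterSystem.lift ⟨b, isLiftable_b⟩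

theorem bHom_simple (i : Fin 4) : bHom (B3aff.simple i) = b i :=
  B3aff.toCoxeterSystem.lift_apply_simple isLiftable_b i

/-- Vectors orthogonal to `J` that span a root basis of type `B₃⁽¹⁾`. -/
def bRoot : Fin 4 → V :=
  ![![1, 2, 0, 1, 0, 0, 0, 0], ![0, 0, 0, 0, 0, 1, 2, 1], ![0, 0, 0, 1, 2, 1, 0, 0],
    ![0, 0, 1, 0, 0, 0, 0, 0]]

/-- The off-diagonal Cartan integers of `bRoot`, up to sign. -/
def bCoeff : Fin 4 → Fin 4 → ℝ :=
  ![![0, 0, 1, 0], ![0, 0, 1, 0], ![1, 1, 0, 2], ![0, 0, 1, 0]]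

theorem bRoot0 : bRoot 0 = ![1, 2, 0, 1, 0, 0, 0, 0] := rfl

theorem bRoot1 : bRoot 1 = ![0, 0, 0, 0, 0, 1, 2, 1] := rfl

theorem bRoot2 : bRoot 2 = ![0, 0, 0, 1, 2, 1, 0, 0] := rfl

theorem bRoot3 : bRoot 3 = ![0, 0, 1, 0, 0, 0, 0, 0] := rfl

/-- For `i = 0, 1, 2` the element `s_k s_p s_q s_k` is the product of the commuting reflections
along `s_k α_p` and `s_k α_q`. It acts as `-1` on their span, and `bRoot i` is their sum. For `i =
3` it is a simple reflection. -/
theorem rep_b_bRoot_self (i : Fin 4) : rep (b i) (bRoot i) = -bRoot i := by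
  match i with
  | 0 => rw [bRoot0, rep_b0]; ext k; fin_cases k <;> simp <;> norm_num
  | 1 => rw [bRoot1, rep_b1]; ext k; fin_cases k <;> simp <;> norm_num
  | 2 => rw [bRoot2, rep_b2]; ext k; fin_cases k <;> simp <;> norm_num
  | 3 => rw [bRoot3, rep_b3]; ext k; fin_cases k <;> simp

theorem rep_b_bRoot (i j : Fin 4) (hij : i ≠ j) :
    rep (b j) (bRoot i) = bRoot i + bCoeff i j • bRoot j := by
  match i, j with
  | 0, 0 | 1, 1 | 2, 2 | 3, 3 => exact absurd rfl hij
  | 0, 1 => rw [bRoot0, rep_b1, bRoot1]; ext k; fin_cases k <;> simp [bCoeff]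
  | 0, 2 => rw [bRoot0, rep_b2, bRoot2]; ext k; fin_cases k <;> simp [bCoeff] <;> norm_num
  | 0, 3 => rw [bRoot0, rep_b3, bRoot3]; ext k; fin_cases k <;> simp [bCoeff]
  | 1, 0 => rw [bRoot1, rep_b0, bRoot0]; ext k; fin_cases k <;> simp [bCoeff]
  | 1, 2 => rw [bRoot1, rep_b2, bRoot2]; ext k; fin_cases k <;> simp [bCoeff] <;> norm_num
  | 1, 3 => rw [bRoot1, rep_b3, bRoot3]; ext k; fin_cases k <;> simp [bCoeff]
  | 2, 0 => rw [bRoot2, rep_b0, bRoot0]; ext k; fin_cases k <;> simp [bCoeff] <;> norm_num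
  | 2, 1 => rw [bRoot2, rep_b1, bRoot1]; ext k; fin_cases k <;> simp [bCoeff] <;> norm_num
  | 2, 3 => rw [bRoot2, rep_b3, bRoot3]; ext k; fin_cases k <;> simp [bCoeff]
  | 3, 0 => rw [bRoot3, rep_b0, bRoot0]; ext k; fin_cases k <;> simp [bCoeff]
  | 3, 1 => rw [bRoot3, rep_b1, bRoot1]; ext k; fin_cases k <;> simp [bCoeff]
  | 3, 2 => rw [bRoot3, rep_b2, bRoot2]; ext k; fin_cases k <;> simp [bCoeff]

theorem bCoeff_cases (i j : Fin 4) (hij : i ≠ j) :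
    (B3aff i j = 2 ∧ bCoeff i j = 0) ∨ (B3aff i j = 3 ∧ bCoeff i j = 1 ∧ bCoeff j i = 1) ∨
      (B3aff i j = 4 ∧ 0 ≤ bCoeff i j ∧ bCoeff i j * bCoeff j i = 2) := by
  fin_cases i <;> fin_cases j <;> first | exact absurd rfl hij | simp [B3aff, bCoeff]

theorem bRoot_nonneg (i : Fin 4) : 0 ≤ bRoot i := by
  intro k
  fin_cases i <;> fin_cases k <;> simp [bRoot]

theorem bRoot_ne_zero (i : Fin 4) : bRoot i ≠ 0 := by
  intro h
  fin_cases i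
  · simpa [bRoot] using congrFun h 0
  · simpa [bRoot] using congrFun h 5
  · simpa [bRoot] using congrFun h 3
  · simpa [bRoot] using congrFun h 2

/-- The vectors `bRoot i` are nonnegative and transform under the `b i` as simple roots, so Tits'
lemma applies inside the larger root space. An element of the kernel moves none of them and is
therefore trivial. -/
theorem bHom_injective : Function.Injective bHom := by
  rw [injective_iff_map_eq_one]
  intro w hw
  have hs : ∀ i v, rep.comp bHom (B3aff.toCoxeterSystem.simple i) v = rep (b i) v := fun i v => by
    rw [← bHom_simple]
    rfl
  refine B3aff.toCoxeterSystem.eq_one_of_nonneg (rep.comp bHom) bRoot bRoot_ne_zero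
    (fun i => (hs i _).trans (rep_b_bRoot_self i))
    (B3aff.toCoxeterSystem.nonneg_of_not_isRightDescent (rep.comp bHom) bRoot bCoeff bRoot_nonneg
      (fun i => (hs i _).trans (rep_b_bRoot_self i))
      (fun i j hij => (hs j _).trans (rep_b_bRoot i j hij)) bCoeff_cases) w fun i => ?_
  rw [MonoidHom.comp_apply, hw, map_one]
  exact bRoot_nonneg i

theorem mem_normalizer_closure {G : Type*} [Group G] {S : Set G} {g : G}
    (h : ∀ s ∈ S, g * s * g⁻¹ ∈ Subgroup.closure S)
    (h' : ∀ s ∈ S, g⁻¹ * s * g ∈ Subgroup.closure S) :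
    g ∈ Subgroup.normalizer (Subgroup.closure S : Set G) := by
  have key : ∀ k : G, (∀ s ∈ S, k * s * k⁻¹ ∈ Subgroup.closure S) →
      ∀ x ∈ Subgroup.closure S, k * x * k⁻¹ ∈ Subgroup.closure S := by
    intro k hk x hx
    have hle : Subgroup.closure S ≤ (Subgroup.closure S).comap (MulAut.conj k).toMonoidHom :=
      (Subgroup.closure_le _).2 hk
    exact hle hx
  refine Subgroup.mem_normalizer_iff.2 fun x => ⟨key g h x, fun hx => ?_⟩
  have h1 := key g⁻¹ (by simpa using h') _ hx
  simpa [mul_assoc] using h1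

/-! ### The stabilizer of `J` -/

/-- The indices of the simple roots in `J`. -/
def idxJ : Fin 4 → Fin 8 := ![0, 3, 5, 7]

theorem range_α_idxJ : Set.range (fun k => α (idxJ k)) = J := by
  ext v
  simp only [Set.mem_range, Fin.exists_fin_succ, J, idxJ, Set.mem_insert_iff,
    Set.mem_singleton_iff]
  simp [eq_comm]

theorem mem_J_iff {v : V} : v ∈ J ↔ ∃ k, α (idxJ k) = v := by
  rw [← range_α_idxJ, Set.mem_range]

theorem mem_setStabilizer_J {g : WE7} (h : ∀ k, ∃ l, rep g (α (idxJ k)) = α (idxJ l)) :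
    g ∈ setStabilizer J := by
  change rep g '' J = J
  have hfin : J.Finite := range_α_idxJ ▸ Set.finite_range _
  -- An injective map of a finite set into itself is onto, so inclusion is enough.
  refine Set.eq_of_subset_of_ncard_le ?_
    (Set.ncard_image_of_injective _ (rep g).injective).ge hfin
  rintro _ ⟨v, hv, rfl⟩
  obtain ⟨k, rfl⟩ := mem_J_iff.1 hv
  obtain ⟨l, hl⟩ := h k
  exact mem_J_iff.2 ⟨l, hl.symm⟩

theorem exists_of_mem_setStabilizer_J {g : WE7} (h : g ∈ setStabilizer J) (k : Fin 4) :
    ∃ l, rep g (α (idxJ k)) = α (idxJ l) := by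
  have h1 : rep g (α (idxJ k)) ∈ J := by
    rw [← show rep g '' J = J from h]
    exact ⟨_, mem_J_iff.2 ⟨k, rfl⟩, rfl⟩
  obtain ⟨l, hl⟩ := mem_J_iff.1 h1
  exact ⟨l, hl.symm⟩

theorem α_idxJ0 : α (idxJ 0) = ![1, 0, 0, 0, 0, 0, 0, 0] := by
  ext k; fin_cases k <;> simp [α, idxJ]

theorem α_idxJ1 : α (idxJ 1) = ![0, 0, 0, 1, 0, 0, 0, 0] := by
  ext k; fin_cases k <;> simp [α, idxJ]

theorem α_idxJ2 : α (idxJ 2) = ![0, 0, 0, 0, 0, 1, 0, 0] := by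
  ext k; fin_cases k <;> simp [α, idxJ]

theorem α_idxJ3 : α (idxJ 3) = ![0, 0, 0, 0, 0, 0, 0, 1] := by
  ext k; fin_cases k <;> simp [α, idxJ]

theorem b_mem_setStabilizer (i : Fin 4) : b i ∈ setStabilizer J := by
  refine mem_setStabilizer_J fun k => ?_
  match i, k with
  | 0, 0 => exact ⟨1, by rw [α_idxJ0, rep_b0, α_idxJ1]; apply vec_ext <;> ring⟩
  | 0, 1 => exact ⟨0, by rw [α_idxJ1, rep_b0, α_idxJ0]; apply vec_ext <;> ring⟩
  | 0, 2 => exact ⟨2, by rw [α_idxJ2, rep_b0]; apply vec_ext <;> ring⟩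
  | 0, 3 => exact ⟨3, by rw [α_idxJ3, rep_b0]; apply vec_ext <;> ring⟩
  | 1, 0 => exact ⟨0, by rw [α_idxJ0, rep_b1]; apply vec_ext <;> ring⟩
  | 1, 1 => exact ⟨1, by rw [α_idxJ1, rep_b1]; apply vec_ext <;> ring⟩
  | 1, 2 => exact ⟨3, by rw [α_idxJ2, rep_b1, α_idxJ3]; apply vec_ext <;> ring⟩
  | 1, 3 => exact ⟨2, by rw [α_idxJ3, rep_b1, α_idxJ2]; apply vec_ext <;> ring⟩
  | 2, 0 => exact ⟨0, by rw [α_idxJ0, rep_b2]; apply vec_ext <;> ring⟩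
  | 2, 1 => exact ⟨2, by rw [α_idxJ1, rep_b2, α_idxJ2]; apply vec_ext <;> ring⟩
  | 2, 2 => exact ⟨1, by rw [α_idxJ2, rep_b2, α_idxJ1]; apply vec_ext <;> ring⟩
  | 2, 3 => exact ⟨3, by rw [α_idxJ3, rep_b2]; apply vec_ext <;> ring⟩
  | 3, 0 => exact ⟨0, by rw [α_idxJ0, rep_b3]; apply vec_ext <;> ring⟩
  | 3, 1 => exact ⟨1, by rw [α_idxJ1, rep_b3]; apply vec_ext <;> ring⟩
  | 3, 2 => exact ⟨2, by rw [α_idxJ2, rep_b3]; apply vec_ext <;> ring⟩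
  | 3, 3 => exact ⟨3, by rw [α_idxJ3, rep_b3]; apply vec_ext <;> ring⟩

theorem auto_mem_setStabilizer : Ext.auto sigmaE7 ∈ setStabilizer J := by
  refine mem_setStabilizer_J fun k => ?_
  simp only [rep_auto, α_injective.eq_iff]
  revert k
  decide

theorem eq_sum_of_forall_not_mem {v : V} (hv : ∀ k, (∀ l, idxJ l ≠ k) → v k = 0) :
    v = ∑ l, v (idxJ l) • α (idxJ l) := by
  have h1 : v 1 = 0 := hv 1 (by decide)
  have h2 : v 2 = 0 := hv 2 (by decide)
  have h4 : v 4 = 0 := hv 4 (by decide)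
  have h6 : v 6 = 0 := hv 6 (by decide)
  ext k
  fin_cases k <;> simp [Fin.sum_univ_succ, idxJ, α, h1, h2, h4, h6]

/-! ### Generation of the stabilizer by descent on length -/

theorem weylRep_mul_simple (w : E7aff.Group) (i : Fin 8) (v : V) :
    weylRep (w * E7aff.toCoxeterSystem.simple i) v = weylRep w (refl i v) := by
  rw [map_mul, ← weylRep_simple]
  rfl

/-- Otherwise `w (α p) + w (α i)` would be nonnegative. Here `w (α p)` is a simple root of `J` and
`w (α i)` is nonpositive, so `w (α i)` would be supported on `J`. As `w⁻¹` preserves the span of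
`J`, this would put `α i` itself in that span. -/
theorem isRightDescent_mul_simple {w : E7aff.Group}
    (hw : SemidirectProduct.inl w ∈ setStabilizer J) {i : Fin 8} {p : Fin 4}
    (hi : ∀ l, idxJ l ≠ i) (hd : E7aff.toCoxeterSystem.IsRightDescent w i) {w' : E7aff.Group}
    (h : weylRep w' (α (idxJ p)) = weylRep w (α (idxJ p) + α i)) :
    E7aff.toCoxeterSystem.IsRightDescent w' (idxJ p) := by
  by_contra hp
  have hnn := weylRep_α_nonneg _ _ hp
  rw [h, map_add] at hnn
  have hnp := weylRep_α_nonpos w i hd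
  obtain ⟨l, hl⟩ := exists_of_mem_setStabilizer_J hw p
  rw [rep_inl] at hl
  rw [hl] at hnn
  have h0 : ∀ k, (∀ m, idxJ m ≠ k) → weylRep w (α i) k = 0 := by
    intro k hk
    have h1 := hnn k
    have h2 := hnp k
    have h3 : α (idxJ l) k = 0 := by simp [α, (hk l).symm]
    rw [Pi.add_apply, h3, zero_add] at h1
    exact le_antisymm h2 h1
  have h4 := congrFun (congrArg (weylRep w⁻¹) (eq_sum_of_forall_not_mem h0)) i
  have h5 : weylRep w⁻¹ (weylRep w (α i)) = α i := by
    rw [← LinearEquiv.mul_apply, ← map_mul, inv_mul_cancel, map_one]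
    rfl
  rw [h5, map_sum, Finset.sum_apply, Finset.sum_eq_zero] at h4
  · simp [α] at h4
  · intro m _
    obtain ⟨n, hn⟩ := exists_of_mem_setStabilizer_J (inv_mem hw) m
    rw [← map_inv, rep_inl] at hn
    rw [map_smul, hn]
    simp [α, (hi n).symm]

/-- The first three factors each lower the length by one: both `w s_i (α p)` and `w s_i s_p (α q)`
have the form covered by `isRightDescent_mul_simple`. The last factor raises it by at most one. -/
theorem length_mul_lt {w : E7aff.Group}
    (hw : SemidirectProduct.inl w ∈ setStabilizer J) {i : Fin 8} {p q : Fin 4}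
    (hi : ∀ l, idxJ l ≠ i) (hip : cartanE7 (idxJ p) i = -1) (hiq : cartanE7 (idxJ q) i = -1)
    (hpq : cartanE7 (idxJ q) (idxJ p) = 0) (hd : E7aff.toCoxeterSystem.IsRightDescent w i) :
    E7aff.toCoxeterSystem.length (w * E7aff.toCoxeterSystem.simple i *
      E7aff.toCoxeterSystem.simple (idxJ p) * E7aff.toCoxeterSystem.simple (idxJ q) *
      E7aff.toCoxeterSystem.simple i) < E7aff.toCoxeterSystem.length w := by
  have h1 := isRightDescent_mul_simple hw (p := p) hi hd
    (w' := w * E7aff.toCoxeterSystem.simple i) (by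
      rw [weylRep_mul_simple, refl_α, hip]; simp)
  have h2 := isRightDescent_mul_simple hw (p := q) hi hd
    (w' := w * E7aff.toCoxeterSystem.simple i * E7aff.toCoxeterSystem.simple (idxJ p)) (by
      rw [weylRep_mul_simple, refl_α, hpq, Int.cast_zero, neg_zero, zero_smul, add_zero,
        weylRep_mul_simple, refl_α, hiq]; simp)
  have h3 := E7aff.toCoxeterSystem.length_mul_simple (w * E7aff.toCoxeterSystem.simple i *
      E7aff.toCoxeterSystem.simple (idxJ p) * E7aff.toCoxeterSystem.simple (idxJ q)) i
  rw [CoxeterSystem.isRightDescent_iff] at hd h1 h2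
  omega

theorem inl_mem_closure_b (w : E7aff.Group) (hw : SemidirectProduct.inl w ∈ setStabilizer J) :
    (SemidirectProduct.inl w : WE7) ∈ Subgroup.closure (Set.range b) := by
  induction hn : E7aff.toCoxeterSystem.length w using Nat.strong_induction_on generalizing w with
  | _ n ih =>
  subst hn
  have step : ∀ (x : E7aff.Group) (i : Fin 4), SemidirectProduct.inl x = b i →
      E7aff.toCoxeterSystem.length (w * x) < E7aff.toCoxeterSystem.length w →
      (SemidirectProduct.inl w : WE7) ∈ Subgroup.closure (Set.range b) := by
    intro x i hx hlt
    have h1 := ih _ hlt (w * x) (by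
      rw [map_mul, hx]; exact mul_mem hw (b_mem_setStabilizer i)) rfl
    have h2 := mul_mem h1 (Subgroup.subset_closure (Set.mem_range_self i))
    rwa [map_mul, hx, mul_assoc, b_mul_self, mul_one] at h2
  by_cases hw1 : w = 1
  · rw [hw1, map_one]
    exact one_mem _
  obtain ⟨i, hd⟩ := E7aff.toCoxeterSystem.exists_rightDescent_of_ne_one hw1
  -- A descent would make the root negative, whereas `w` sends roots of `J` to positive roots.
  have hJ : ∀ l, idxJ l ≠ i := by
    rintro l rfl
    obtain ⟨m, hm⟩ := exists_of_mem_setStabilizer_J hw l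
    rw [rep_inl] at hm
    have h1 := weylRep_α_nonpos w _ hd
    rw [hm] at h1
    exact α_ne_zero _ (le_antisymm h1 (α_nonneg _))
  have hcases : i = 1 ∨ i = 6 ∨ i = 4 ∨ i = 2 := by
    revert hJ
    clear hd
    revert i
    decide
  -- The nodes `1`, `6`, `4` each have two neighbours in `J`, which supply `p` and `q`. The node `2`
  -- has none, and there `b 3` is the simple reflection itself.
  rcases hcases with rfl | rfl | rfl | rfl
  · refine step (E7aff.simple 1 * E7aff.simple 3 * E7aff.simple 0 * E7aff.simple 1) 0
      (by simp [b, word, Ext.s, mul_assoc]) ?_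
    rw [← mul_assoc, ← mul_assoc, ← mul_assoc]
    exact length_mul_lt (p := 1) (q := 0) hw hJ rfl rfl rfl hd
  · refine step (E7aff.simple 6 * E7aff.simple 5 * E7aff.simple 7 * E7aff.simple 6) 1
      (by simp [b, word, Ext.s, mul_assoc]) ?_
    rw [← mul_assoc, ← mul_assoc, ← mul_assoc]
    exact length_mul_lt (p := 2) (q := 3) hw hJ rfl rfl rfl hd
  · refine step (E7aff.simple 4 * E7aff.simple 5 * E7aff.simple 3 * E7aff.simple 4) 2
      (by simp [b, word, Ext.s, mul_assoc]) ?_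
    rw [← mul_assoc, ← mul_assoc, ← mul_assoc]
    exact length_mul_lt (p := 2) (q := 1) hw hJ rfl rfl rfl hd
  · exact step (E7aff.simple 2) 3 (by simp [b, word, Ext.s]) hd

theorem closure_b_sup_zpowers :
    Subgroup.closure (Set.range b) ⊔ Subgroup.zpowers (Ext.auto sigmaE7) = setStabilizer J := by
  apply le_antisymm
  · rw [sup_le_iff, Subgroup.closure_le, Subgroup.zpowers_le]
    refine ⟨?_, auto_mem_setStabilizer⟩
    rintro _ ⟨i, rfl⟩
    exact b_mem_setStabilizer i
  · intro g hg
    obtain ⟨n, hn⟩ := Subgroup.mem_zpowers_iff.1 g.right.2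
    have hr : (SemidirectProduct.inr g.right : WE7) = Ext.auto sigmaE7 ^ n := by
      rw [Ext.auto, ← map_zpow]
      exact congrArg _ (Subtype.ext hn.symm)
    have hg' := SemidirectProduct.inl_left_mul_inr_right g
    rw [hr] at hg'
    have hl : SemidirectProduct.inl g.left ∈ setStabilizer J := by
      rw [eq_mul_inv_of_mul_eq hg']
      exact mul_mem hg (inv_mem (zpow_mem auto_mem_setStabilizer n))
    rw [← hg']
    exact mul_mem (Subgroup.mem_sup_left (inl_mem_closure_b _ hl))
      (Subgroup.mem_sup_right (zpow_mem (Subgroup.mem_zpowers _) n))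

theorem auto_mul_self : Ext.auto sigmaE7 * Ext.auto sigmaE7 = 1 := by
  refine eq_one_of_rep_vec fun _ _ _ _ _ _ _ _ => ?_
  rw [map_mul, LinearEquiv.mul_apply, rep_auto_vec, rep_auto_vec]

theorem auto_conj_b (i : Fin 4) :
    Ext.auto sigmaE7 * b i * (Ext.auto sigmaE7)⁻¹ = b (sigmaB3.1 i) := by
  rw [inv_eq_of_mul_eq_one_left auto_mul_self, ← mul_inv_eq_one,
    inv_eq_of_mul_eq_one_left (b_mul_self _)]
  refine eq_one_of_rep_vec fun _ _ _ _ _ _ _ _ => ?_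
  simp only [map_mul, LinearEquiv.mul_apply]
  match i with
  | 0 =>
    rw [show sigmaB3.1 0 = 1 by decide, rep_b1, rep_auto_vec, rep_b0, rep_auto_vec]
    apply vec_ext <;> ring
  | 1 =>
    rw [show sigmaB3.1 1 = 0 by decide, rep_b0, rep_auto_vec, rep_b1, rep_auto_vec]
    apply vec_ext <;> ring
  | 2 =>
    rw [show sigmaB3.1 2 = 2 by decide, rep_b2, rep_auto_vec, rep_b2, rep_auto_vec]
    apply vec_ext <;> ring
  | 3 =>
    rw [show sigmaB3.1 3 = 3 by decide, rep_b3, rep_auto_vec, rep_b3, rep_auto_vec]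
    apply vec_ext <;> ring

theorem b_right (i : Fin 4) : (b i).right = 1 := by
  have h : ∃ l, b i = word l := by
    match i with
    | 0 => exact ⟨_, rfl⟩
    | 1 => exact ⟨_, rfl⟩
    | 2 => exact ⟨_, rfl⟩
    | 3 => exact ⟨_, rfl⟩
  obtain ⟨l, hl⟩ := h
  obtain ⟨w, hw⟩ := exists_word_eq_inl l
  rw [hl, hw, SemidirectProduct.right_inl]

theorem isSemidirect_setStabilizer_J :
    IsSemidirect (setStabilizer J) (Subgroup.closure (Set.range b))
      (Subgroup.zpowers (Ext.auto sigmaE7)) where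
  normal := by
    rw [← closure_b_sup_zpowers, sup_le_iff, Subgroup.zpowers_le]
    refine ⟨Subgroup.le_normalizer, ?_⟩
    have h : ∀ s ∈ Set.range b, Ext.auto sigmaE7 * s * (Ext.auto sigmaE7)⁻¹ ∈
        Subgroup.closure (Set.range b) := by
      rintro _ ⟨i, rfl⟩
      rw [auto_conj_b]
      exact Subgroup.subset_closure ⟨_, rfl⟩
    refine mem_normalizer_closure h ?_
    have hinv := inv_eq_of_mul_eq_one_left auto_mul_self
    rwa [hinv] at h ⊢
  disjoint := by
    rw [eq_bot_iff]
    rintro x ⟨hx, hx'⟩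
    obtain ⟨n, rfl⟩ := Subgroup.mem_zpowers_iff.1 hx'
    -- The `b i` lie in the kernel of the projection to `⟨σ⟩`, on which the powers of `σ` are
    -- detected.
    have hle : Subgroup.closure (Set.range b) ≤
        (SemidirectProduct.rightHom : WE7 →* Subgroup.zpowers sigmaE7).ker := by
      rw [Subgroup.closure_le]
      rintro _ ⟨i, rfl⟩
      exact b_right i
    have h1 := MonoidHom.mem_ker.1 (hle hx)
    rw [Ext.auto, ← map_zpow, SemidirectProduct.rightHom_inr] at h1
    rw [Subgroup.mem_bot, Ext.auto, ← map_zpow, h1, map_one]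
  sup_eq := closure_b_sup_zpowers

/-! ### The normalizer of `W_J` -/

/-- The reflections along the simple roots in `J`. -/
noncomputable def sJ (k : Fin 4) : WE7 := Ext.s sigmaE7 (idxJ k)

theorem α_mem_roots (i : Fin 8) : α i ∈ roots := ⟨1, i, by rw [map_one]; rfl⟩

theorem reflSubgroup_J : reflSubgroup J = Subgroup.closure (Set.range sJ) := by
  rw [← range_α_idxJ]
  exact reflSubgroup_range (fun k => α_mem_roots _) fun k => isReflAlong_s _

theorem form_idxJ (k l : Fin 4) : form (α (idxJ k)) (α (idxJ l)) = if k = l then 2 else 0 := by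
  rw [form_α_α]
  have h : cartanE7 (idxJ k) (idxJ l) = if k = l then 2 else 0 := by
    revert k l
    decide
  rw [h]
  split_ifs <;> simp

theorem sJ_mul_self (k : Fin 4) : sJ k * sJ k = 1 := by
  have h := E7aff.toCoxeterSystem.simple_mul_simple_self (idxJ k)
  rw [sJ, Ext.s, ← map_mul]
  exact (congrArg _ h).trans (map_one _)

/-- Orthogonality makes the four reflections commuting involutions, so an element of `W_J` is
recorded by the subset of them it involves, with indicator `d`. -/
theorem rep_of_mem_reflSubgroup_J {x : WE7} (hx : x ∈ reflSubgroup J) :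
    ∃ d : Fin 4 → ℝ, (∀ k, d k = 0 ∨ d k = 1) ∧
      ∀ v, rep x v = v - ∑ k, (d k * form v (α (idxJ k))) • α (idxJ k) := by
  rw [reflSubgroup_J] at hx
  have step : ∀ (j : Fin 4) (y : WE7), (∃ d : Fin 4 → ℝ, (∀ k, d k = 0 ∨ d k = 1) ∧
      ∀ v, rep y v = v - ∑ k, (d k * form v (α (idxJ k))) • α (idxJ k)) →
      ∃ d : Fin 4 → ℝ, (∀ k, d k = 0 ∨ d k = 1) ∧
      ∀ v, rep (sJ j * y) v = v - ∑ k, (d k * form v (α (idxJ k))) • α (idxJ k) := by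
    rintro j y ⟨d, hd, hy⟩
    -- Multiplication by the `j`-th reflection toggles membership of `j` in the subset.
    refine ⟨Function.update d j (1 - d j), fun k => ?_, fun v => ?_⟩
    · by_cases hk : k = j
      · subst hk
        rcases hd k with h | h <;> simp [h]
      · simpa [hk] using hd k
    · have hf : form (rep y v) (α (idxJ j)) =
          form v (α (idxJ j)) - 2 * d j * form v (α (idxJ j)) := by
        rw [hy, map_sub, map_sum, LinearMap.sub_apply, LinearMap.sum_apply]
        simp only [map_smul, LinearMap.smul_apply, form_idxJ]
        simp
        ring
      have hu : ∀ k, (Function.update d j (1 - d j) k * form v (α (idxJ k))) • α (idxJ k) =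
          (d k * form v (α (idxJ k))) • α (idxJ k) +
            if k = j then (form v (α (idxJ j)) - 2 * d j * form v (α (idxJ j))) • α (idxJ j)
            else 0 := by
        intro k
        by_cases hk : k = j
        · subst hk
          simp only [Function.update_self, if_true]
          module
        · simp [hk]
      rw [map_mul, LinearEquiv.mul_apply, show rep (sJ j) (rep y v) = _ from
        isReflAlong_s _ _, hf, hy]
      simp only [hu, Finset.sum_add_distrib, Finset.sum_ite_eq', Finset.mem_univ, if_true]
      abel
  induction hx using Subgroup.closure_induction_left with
  | one => exact ⟨0, fun _ => Or.inl rfl, fun v => by simp⟩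
  | mul_left s hs y _ ih =>
    obtain ⟨j, rfl⟩ := hs
    exact step j y ih
  | inv_mul_cancel s hs y _ ih =>
    obtain ⟨j, rfl⟩ := hs
    rw [inv_eq_of_mul_eq_one_left (sJ_mul_self j)]
    exact step j y ih

/-- Since `x` negates `γ ≠ 0`, it is nontrivial and some `d k = 1`. Then `x` negates `α_k`, so `2
α_k = (α_k · γ) γ`. Pairing with `α_k` gives `(α_k · γ)² = 4`. -/
theorem eq_or_eq_neg_of_isReflAlong {x : WE7} (hx : x ∈ reflSubgroup J) {γ : V}
    (h : IsReflAlong x γ) (hγ : form γ γ = 2) :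
    ∃ k, γ = α (idxJ k) ∨ γ = -α (idxJ k) := by
  obtain ⟨d, hd, hrep⟩ := rep_of_mem_reflSubgroup_J hx
  have hγ0 : γ ≠ 0 := by
    rintro rfl
    simp at hγ
  obtain ⟨k, hk⟩ : ∃ k, d k ≠ 0 := by
    by_contra! h0
    have h1 := h γ
    rw [hrep, hγ] at h1
    simp only [h0, zero_mul, zero_smul, Finset.sum_const_zero, sub_zero] at h1
    have h2 : (2 : ℝ) • γ = 0 := by rw [← sub_eq_self]; exact h1.symm
    exact hγ0 ((smul_eq_zero.1 h2).resolve_left two_ne_zero)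
  have hk1 := (hd k).resolve_left hk
  have h1 := h (α (idxJ k))
  rw [hrep] at h1
  simp only [form_idxJ, mul_ite, mul_zero, ite_smul, zero_smul, Finset.sum_ite_eq,
    Finset.mem_univ, if_true, hk1, one_mul, sub_right_inj] at h1
  have h2 := congrArg (fun v => form v (α (idxJ k))) h1
  simp only [map_smul, LinearMap.smul_apply, form_idxJ, if_true, smul_eq_mul,
    form_symm γ] at h2
  have h3 : (form (α (idxJ k)) γ - 2) * (form (α (idxJ k)) γ + 2) = 0 := by linarith
  refine ⟨k, ?_⟩
  rcases mul_eq_zero.1 h3 with h4 | h4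
  · left
    rw [sub_eq_zero.1 h4] at h1
    exact (smul_right_injective V (two_ne_zero (α := ℝ)) h1).symm
  · right
    rw [eq_neg_of_add_eq_zero_left h4] at h1
    refine smul_right_injective V (two_ne_zero (α := ℝ)) ?_
    change (2 : ℝ) • γ = (2 : ℝ) • -α (idxJ k)
    rw [smul_neg, h1, neg_smul, neg_neg]

theorem α_ne_neg_α (i j : Fin 8) : α i ≠ -α j := by
  intro h
  have h1 := α_nonneg i
  rw [h, neg_nonneg] at h1
  exact α_ne_zero j (le_antisymm h1 (α_nonneg j))

theorem exists_mem_reflSubgroup_J_neg (K : Finset (Fin 4)) :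
    ∃ x ∈ reflSubgroup J, ∀ k, rep x (α (idxJ k)) =
      if k ∈ K then -α (idxJ k) else α (idxJ k) := by
  induction K using Finset.induction_on with
  | empty => exact ⟨1, one_mem _, fun k => by rw [map_one]; simp⟩
  | insert j K hj ih =>
    obtain ⟨x, hx, h⟩ := ih
    refine ⟨sJ j * x, mul_mem ?_ hx, fun k => ?_⟩
    · rw [reflSubgroup_J]
      exact Subgroup.subset_closure ⟨j, rfl⟩
    · have hs : ∀ k, rep (sJ j) (α (idxJ k)) = if k = j then -α (idxJ k) else α (idxJ k) := by
        intro k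
        rw [show rep (sJ j) (α (idxJ k)) = _ from isReflAlong_s _ _, form_idxJ]
        split_ifs with hk
        · subst hk
          module
        · simp
      rw [map_mul, LinearEquiv.mul_apply, h]
      by_cases hkj : k = j
      · subst hkj
        rw [if_neg hj, hs]
        simp
      · by_cases hkK : k ∈ K
        · rw [if_pos hkK, map_neg, hs]
          simp [hkj, hkK]
        · rw [if_neg hkK, hs]
          simp [hkj, hkK]

theorem setStabilizer_J_le_normalizer :
    setStabilizer J ≤ Subgroup.normalizer (reflSubgroup J : Set WE7) := by
  have key : ∀ g ∈ setStabilizer J, ∀ s ∈ Set.range sJ,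
      g * s * g⁻¹ ∈ Subgroup.closure (Set.range sJ) := by
    rintro g hg _ ⟨k, rfl⟩
    obtain ⟨l, hl⟩ := exists_of_mem_setStabilizer_J hg k
    have h1 := (isReflAlong_s (idxJ k)).conj g
    rw [hl] at h1
    exact Subgroup.subset_closure ⟨l, (isReflAlong_s (idxJ l)).eq h1⟩
  intro g hg
  rw [reflSubgroup_J]
  refine mem_normalizer_closure (key g hg) ?_
  simpa using key g⁻¹ (inv_mem hg)

theorem exists_mul_mem_setStabilizer_J {g : WE7}
    (hg : g ∈ Subgroup.normalizer (reflSubgroup J : Set WE7)) :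
    ∃ x ∈ reflSubgroup J, x * g ∈ setStabilizer J := by
  classical
  have h1 : ∀ j, ∃ k, rep g (α (idxJ j)) = α (idxJ k) ∨ rep g (α (idxJ j)) = -α (idxJ k) := by
    intro j
    have hj : sJ j ∈ reflSubgroup J := by
      rw [reflSubgroup_J]
      exact Subgroup.subset_closure ⟨j, rfl⟩
    refine eq_or_eq_neg_of_isReflAlong ((Subgroup.mem_normalizer_iff.1 hg _).1 hj)
      ((isReflAlong_s (idxJ j)).conj g) ?_
    rw [form_rep, form_idxJ, if_pos rfl]
  -- The element `x` flips exactly the roots of `J` that `g` reaches with a minus sign. No root is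
  -- reached with both signs, because `g` is injective and no simple root is the negative of
  -- another.
  obtain ⟨x, hx, hxr⟩ := exists_mem_reflSubgroup_J_neg
    (Finset.univ.filter fun k => ∃ j, rep g (α (idxJ j)) = -α (idxJ k))
  refine ⟨x, hx, mem_setStabilizer_J fun j => ?_⟩
  obtain ⟨k, hk | hk⟩ := h1 j
  · refine ⟨k, ?_⟩
    rw [map_mul, LinearEquiv.mul_apply, hk, hxr, if_neg]
    rw [Finset.mem_filter]
    rintro ⟨-, j', hj'⟩
    rw [← hk, ← map_neg] at hj'
    exact α_ne_neg_α _ _ ((rep g).injective hj')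
  · refine ⟨k, ?_⟩
    rw [map_mul, LinearEquiv.mul_apply, hk, map_neg, hxr, if_pos, neg_neg]
    exact Finset.mem_filter.2 ⟨Finset.mem_univ _, j, hk⟩

theorem isSemidirect_normalizer_J :
    IsSemidirect (Subgroup.normalizer (reflSubgroup J : Set WE7)) (reflSubgroup J)
      (setStabilizer J) where
  normal := le_rfl
  disjoint := by
    rw [eq_bot_iff]
    rintro x ⟨hx, hx'⟩
    obtain ⟨d, hd, hrep⟩ := rep_of_mem_reflSubgroup_J hx
    have hd0 : ∀ k, d k = 0 := by
      intro k
      -- If `d k = 1`, then `x` sends `α_k` to `-α_k`, which is not in `J`.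
      refine (hd k).resolve_right fun hk => ?_
      obtain ⟨l, hl⟩ := exists_of_mem_setStabilizer_J hx' k
      rw [hrep] at hl
      simp only [form_idxJ, mul_ite, mul_zero, ite_smul, zero_smul, Finset.sum_ite_eq,
        Finset.mem_univ, if_true, hk, one_mul] at hl
      refine α_ne_neg_α (idxJ l) (idxJ k) ?_
      rw [← hl]
      module
    refine rep_injective (LinearEquiv.ext fun v => ?_)
    rw [hrep, map_one]
    simp [hd0]
  sup_eq := by
    apply le_antisymm
    · exact sup_le Subgroup.le_normalizer setStabilizer_J_le_normalizer
    · intro g hg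
      obtain ⟨x, hx, hxg⟩ := exists_mul_mem_setStabilizer_J hg
      rw [← inv_mul_cancel_left x g]
      exact mul_mem (Subgroup.mem_sup_left (inv_mem hx)) (Subgroup.mem_sup_right hxg)

/-! ### The homomorphisms from `W(4A₁)` and `W̃(B₃⁽¹⁾)` -/

theorem isLiftable_sJ : fourA1.IsLiftable sJ := by
  intro k l
  have h : fourA1 k l = E7aff (idxJ k) (idxJ l) := by
    fin_cases k <;> fin_cases l <;> rfl
  have h1 := E7aff.toCoxeterSystem.simple_mul_simple_pow (idxJ k) (idxJ l)
  rw [h, sJ, sJ, Ext.s, Ext.s, ← map_mul, ← map_pow]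
  exact (congrArg _ h1).trans (map_one _)

/-- The homomorphism `W(4A₁) → W̃(E₇⁽¹⁾)` onto `W_J`. -/
noncomputable def sJHom : fourA1.Group →* WE7 := fourA1.toCoxeterSystem.lift ⟨sJ, isLiftable_sJ⟩

theorem sJHom_simple (i : Fin 4) : sJHom (fourA1.simple i) = sJ i :=
  fourA1.toCoxeterSystem.lift_apply_simple isLiftable_sJ i

theorem sJHom_injective : Function.Injective sJHom := by
  rw [injective_iff_map_eq_one]
  intro w hw
  have hs : ∀ i v, rep.comp sJHom (fourA1.toCoxeterSystem.simple i) v = refl (idxJ i) v :=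
    fun i v => by
      rw [← rep_s, ← sJ, ← sJHom_simple]
      rfl
  have h0 : ∀ i j, i ≠ j → fourA1 i j = 2 ∧ cartanE7 (idxJ i) (idxJ j) = 0 := by
    intro i j hij
    fin_cases i <;> fin_cases j <;> first | exact absurd rfl hij | exact ⟨rfl, rfl⟩
  refine fourA1.toCoxeterSystem.eq_one_of_nonneg (rep.comp sJHom) (fun k => α (idxJ k))
    (fun k => α_ne_zero _) (fun i => (hs i _).trans (refl_α_self _))
    (fourA1.toCoxeterSystem.nonneg_of_not_isRightDescent (rep.comp sJHom) (fun k => α (idxJ k))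
      0 (fun k => α_nonneg _) (fun i => (hs i _).trans (refl_α_self _))
      (fun i j hij => (hs j _).trans ?_) fun i j hij => Or.inl ⟨(h0 i j hij).1, rfl⟩) w fun i => ?_
  · rw [refl_α, (h0 i j hij).2]
    simp
  · rw [MonoidHom.comp_apply, hw, map_one]
    exact α_nonneg _

theorem range_lift {B G : Type*} [Group G] {M : CoxeterMatrix B} (f : M.Group →* G) :
    f.range = Subgroup.closure (Set.range fun i => f (M.simple i)) := by
  rw [MonoidHom.range_eq_map, ← M.toCoxeterSystem.subgroup_closure_range_simple,
    MonoidHom.map_closure, ← Set.range_comp]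
  rfl

/-- The diagram automorphism of `B₃⁽¹⁾` as a generator of the cyclic group it generates. -/
def genB3 : Subgroup.zpowers sigmaB3 := ⟨sigmaB3, Subgroup.mem_zpowers _⟩

theorem genB3_mul_self : genB3 * genB3 = 1 := by
  refine Subtype.ext (Subtype.ext (Equiv.ext fun i => ?_))
  revert i
  decide

theorem mem_zpowers_genB3 (x : Subgroup.zpowers sigmaB3) : x ∈ Subgroup.zpowers genB3 := by
  obtain ⟨n, hn⟩ := Subgroup.mem_zpowers_iff.1 x.2
  exact Subgroup.mem_zpowers_iff.2 ⟨n, Subtype.ext hn⟩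

theorem eq_one_or_eq_genB3 (x : Subgroup.zpowers sigmaB3) : x = 1 ∨ x = genB3 := by
  obtain ⟨n, rfl⟩ := Subgroup.mem_zpowers_iff.1 (mem_zpowers_genB3 x)
  rcases Int.even_or_odd' n with ⟨m, rfl | rfl⟩
  · left
    rw [zpow_mul, zpow_ofNat, pow_two, genB3_mul_self, one_zpow]
  · right
    rw [zpow_add, zpow_mul, zpow_ofNat, pow_two, genB3_mul_self, one_zpow, one_mul, zpow_one]

theorem orderOf_auto_dvd : orderOf (Ext.auto sigmaE7) ∣ orderOf genB3 := by
  have h : orderOf genB3 = 2 := by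
    refine orderOf_eq_prime (by rw [pow_two, genB3_mul_self]) fun h => ?_
    have h1 : sigmaB3.1 0 = 0 :=
      congrArg (fun x : Subgroup.zpowers sigmaB3 => x.1.1 0) h
    exact absurd h1 (by decide)
  rw [h]
  exact orderOf_dvd_of_pow_eq_one (by rw [pow_two, auto_mul_self])

/-- The homomorphism `⟨σ⟩ → W̃(E₇⁽¹⁾)` from the diagram automorphisms of `B₃⁽¹⁾` sending generator to
generator. -/
noncomputable def autoHom : Subgroup.zpowers sigmaB3 →* WE7 :=
  monoidHomOfForallMemZpowers mem_zpowers_genB3 orderOf_auto_dvd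

theorem autoHom_genB3 : autoHom genB3 = Ext.auto sigmaE7 :=
  monoidHomOfForallMemZpowers_apply_gen _ _

/-- The homomorphism `W̃(B₃⁽¹⁾) → W̃(E₇⁽¹⁾)` with `s_i ↦ b_i` and `σ ↦ σ`. -/
noncomputable def extHom : WB3 →* WE7 :=
  SemidirectProduct.lift bHom autoHom (by
    intro g
    refine B3aff.toCoxeterSystem.ext_simple fun i => ?_
    rcases eq_one_or_eq_genB3 g with rfl | rfl
    · simp
    · change bHom (diagramHom B3aff sigmaB3 (B3aff.simple i)) =
        autoHom genB3 * bHom (B3aff.simple i) * (autoHom genB3)⁻¹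
      rw [diagramHom_simple, bHom_simple, bHom_simple, autoHom_genB3, auto_conj_b])

theorem extHom_s (i : Fin 4) : extHom (Ext.s sigmaB3 i) = b i := by
  rw [extHom, Ext.s, SemidirectProduct.lift_inl, bHom_simple]

theorem extHom_auto : extHom (Ext.auto sigmaB3) = Ext.auto sigmaE7 := by
  rw [extHom, Ext.auto, SemidirectProduct.lift_inr]
  exact autoHom_genB3

theorem bHom_right (w : B3aff.Group) : (bHom w).right = 1 := by
  have h : (SemidirectProduct.rightHom : WE7 →* Subgroup.zpowers sigmaE7).comp bHom = 1 := by
    refine B3aff.toCoxeterSystem.ext_simple fun i => ?_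
    rw [MonoidHom.comp_apply]
    exact (congrArg _ (bHom_simple i)).trans (b_right i)
  exact DFunLike.congr_fun h w

theorem extHom_injective : Function.Injective extHom := by
  rw [injective_iff_map_eq_one]
  intro x hx
  have hx' : bHom x.left * autoHom x.right = 1 := hx
  -- The image of `bHom` has trivial `σ`-component, while `σ` moves the node `0`; so the two factors
  -- can be separated.
  have hr : x.right = 1 := by
    refine (eq_one_or_eq_genB3 _).resolve_right fun h => ?_
    rw [h, autoHom_genB3] at hx'
    have h1 := congrArg SemidirectProduct.right hx'
    rw [SemidirectProduct.mul_right, bHom_right, one_mul] at h1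
    have h2 : sigmaE7.1 0 = 0 :=
      congrArg (fun x : Subgroup.zpowers sigmaE7 => x.1.1 0) h1
    exact absurd h2 (by decide)
  rw [hr, map_one, mul_one] at hx'
  exact SemidirectProduct.ext (bHom_injective (hx'.trans (map_one _).symm)) hr

theorem sJHom_range : sJHom.range = reflSubgroup J := by
  rw [range_lift, reflSubgroup_J]
  simp only [sJHom_simple]

theorem extHom_range : extHom.range = setStabilizer J := by
  rw [← closure_b_sup_zpowers]
  apply le_antisymm
  · rintro _ ⟨x, rfl⟩
    change bHom x.left * autoHom x.right ∈ _
    refine mul_mem (Subgroup.mem_sup_left ?_) (Subgroup.mem_sup_right ?_)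
    · have h : bHom x.left ∈ bHom.range := ⟨_, rfl⟩
      rw [range_lift] at h
      simpa only [bHom_simple] using h
    · rcases eq_one_or_eq_genB3 x.right with h | h
      · rw [h, map_one]
        exact one_mem _
      · rw [h, autoHom_genB3]
        exact Subgroup.mem_zpowers _
  · rw [sup_le_iff, Subgroup.closure_le, Subgroup.zpowers_le]
    refine ⟨?_, _, extHom_auto⟩
    rintro _ ⟨i, rfl⟩
    exact ⟨_, extHom_s i⟩

/-! ### Conjugation by `u` -/

theorem IsSemidirect.map {G G' : Type*} [Group G] [Group G'] {K N H : Subgroup G}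
    (h : IsSemidirect K N H) (f : G ≃* G') :
    IsSemidirect (K.map f.toMonoidHom) (N.map f.toMonoidHom) (H.map f.toMonoidHom) where
  normal := by
    rw [← Subgroup.map_equiv_normalizer_eq]
    exact Subgroup.map_mono h.normal
  disjoint := by
    rw [← Subgroup.map_inf _ _ _ f.injective, h.disjoint, Subgroup.map_bot]
  sup_eq := by rw [← Subgroup.map_sup, h.sup_eq]

theorem setStabilizer_image (g : WE7) (S : Set V) :
    setStabilizer (rep g '' S) = (setStabilizer S).map (MulAut.conj g).toMonoidHom := by
  ext x
  rw [Subgroup.mem_map_equiv]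
  change rep x '' (rep g '' S) = rep g '' S ↔ rep (g⁻¹ * x * g) '' S = S
  have h : rep g '' (rep (g⁻¹ * x * g) '' S) = rep x '' (rep g '' S) := by
    rw [← Set.image_comp, ← Set.image_comp]
    congr 1
    funext v
    simp only [Function.comp_apply, ← LinearEquiv.mul_apply, ← map_mul]
    congr 2
    group
  rw [← h]
  exact (Set.image_injective.2 (rep g).injective).eq_iff

/-- The roots in `uJ`. -/
def rootUJ : Fin 4 → V := ![α 0, α 6, α 3, α 5 + α 6 + α 7]

theorem range_rootUJ : Set.range rootUJ = uJ := by
  ext v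
  simp only [Set.mem_range, Fin.exists_fin_succ, uJ, rootUJ, Set.mem_insert_iff,
    Set.mem_singleton_iff]
  simp [eq_comm]

/-- The matching of indices, and not only of sets, is what makes each simple reflection of `W(4A₁)`
correspond to the prescribed `t k`. -/
theorem rep_u (k : Fin 4) : rep u (α (idxJ k)) = rootUJ k := by
  rw [show u = word [5, 4, 3, 6, 5, 4, 2] from rfl]
  simp only [rep_word_cons, rep_word_nil]
  match k with
  | 0 =>
    rw [α_idxJ0, refl_vec2, refl_vec4, refl_vec5, refl_vec6, refl_vec3, refl_vec4, refl_vec5]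
    ext k; fin_cases k <;> simp [rootUJ, α]
  | 1 =>
    rw [α_idxJ1, refl_vec2, refl_vec4, refl_vec5, refl_vec6, refl_vec3, refl_vec4, refl_vec5]
    ext k; fin_cases k <;> simp [rootUJ, α]
  | 2 =>
    rw [α_idxJ2, refl_vec2, refl_vec4, refl_vec5, refl_vec6, refl_vec3, refl_vec4, refl_vec5]
    ext k; fin_cases k <;> simp [rootUJ, α]
  | 3 =>
    rw [α_idxJ3, refl_vec2, refl_vec4, refl_vec5, refl_vec6, refl_vec3, refl_vec4, refl_vec5]
    ext k; fin_cases k <;> simp [rootUJ, α]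

theorem image_u_J : rep u '' J = uJ := by
  rw [← range_α_idxJ, ← range_rootUJ, ← Set.range_comp]
  simp only [Function.comp_def, rep_u]

theorem rootUJ_mem_roots (k : Fin 4) : rootUJ k ∈ roots := by
  rw [← rep_u, show u = word [5, 4, 3, 6, 5, 4, 2] from rfl]
  exact rep_word_mem_roots _ _

theorem isReflAlong_t (k : Fin 4) : IsReflAlong (t k) (rootUJ k) := by
  have h1 : ∀ i, word [i] = Ext.s sigmaE7 i := fun i => by simp [word]
  match k with
  | 0 => rw [show t 0 = word [0] from rfl, h1]; exact isReflAlong_s 0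
  | 1 => rw [show t 1 = word [6] from rfl, h1]; exact isReflAlong_s 6
  | 2 => rw [show t 2 = word [3] from rfl, h1]; exact isReflAlong_s 3
  | 3 =>
    have hinv : ∀ i, (Ext.s sigmaE7 i)⁻¹ = Ext.s sigmaE7 i := fun i => by
      rw [Ext.s, ← map_inv]
      exact congrArg _ (E7aff.toCoxeterSystem.inv_simple i)
    have h := (isReflAlong_s 5).conj (word [7, 6])
    have hw : word [7, 6] * Ext.s sigmaE7 5 * (word [7, 6])⁻¹ = t 3 := by
      simp [word, t, hinv, mul_assoc]
    have hr : rep (word [7, 6]) (α 5) = rootUJ 3 := by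
      rw [show α 5 = ![0, 0, 0, 0, 0, 1, 0, 0] from α_idxJ2]
      simp only [rep_word_cons, rep_word_nil]
      rw [refl_vec6, refl_vec7]
      ext k; fin_cases k <;> simp [rootUJ, α]
    rwa [hw, hr] at h

theorem conj_u_sJ (k : Fin 4) : u * sJ k * u⁻¹ = t k := by
  have h := (isReflAlong_s (idxJ k)).conj u
  rw [rep_u] at h
  exact h.eq (isReflAlong_t k)

theorem reflSubgroup_uJ : reflSubgroup uJ = Subgroup.closure (Set.range t) := by
  rw [← range_rootUJ]
  exact reflSubgroup_range rootUJ_mem_roots isReflAlong_t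

theorem map_conj_closure_range {ι G : Type*} [Group G] (g : G) (f : ι → G) :
    (Subgroup.closure (Set.range f)).map (MulAut.conj g).toMonoidHom =
      Subgroup.closure (Set.range fun i => g * f i * g⁻¹) := by
  rw [MonoidHom.map_closure, ← Set.range_comp]
  rfl

theorem map_conj_reflSubgroup_J :
    (reflSubgroup J).map (MulAut.conj u).toMonoidHom = reflSubgroup uJ := by
  rw [reflSubgroup_J, map_conj_closure_range, reflSubgroup_uJ]
  simp only [conj_u_sJ]

theorem normalizer_reflSubgroup_uJ :
    Subgroup.normalizer (reflSubgroup uJ : Set WE7) =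
      (Subgroup.normalizer (reflSubgroup J : Set WE7)).map (MulAut.conj u).toMonoidHom := by
  rw [Subgroup.map_equiv_normalizer_eq, map_conj_reflSubgroup_J]

theorem setStabilizer_uJ :
    setStabilizer uJ = (setStabilizer J).map (MulAut.conj u).toMonoidHom := by
  rw [← image_u_J, setStabilizer_image]

end AffineWeyl

/-! ### The statement for `uJ` -/

open AffineWeyl
theorem mainTheorem6 :
    (rep u '' J = uJ ∧ uJ ⊆ roots) ∧
    reflSubgroup uJ = Subgroup.closure (Set.range t) ∧
    Subgroup.normalizer (reflSubgroup uJ : Set WE7) =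
      (Subgroup.normalizer (reflSubgroup J : Set WE7)).map (MulAut.conj u).toMonoidHom ∧
    IsSemidirect (Subgroup.normalizer (reflSubgroup uJ : Set WE7))
      (reflSubgroup uJ) (setStabilizer uJ) ∧
    IsSemidirect (setStabilizer uJ)
      (Subgroup.closure (Set.range ub)) (Subgroup.zpowers uσ) ∧
    ∃ (φ : WB3 →* MulAut fourA1.Group)
      (e : (fourA1.Group ⋊[φ] WB3) ≃* Subgroup.normalizer (reflSubgroup uJ : Set WE7)),
      (∀ i, ((e (SemidirectProduct.inl (fourA1.simple i)) :
          Subgroup.normalizer (reflSubgroup uJ : Set WE7)) : WE7) = t i) ∧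
      (∀ i, ((e (SemidirectProduct.inr (Ext.s sigmaB3 i)) :
          Subgroup.normalizer (reflSubgroup uJ : Set WE7)) : WE7) = ub i) ∧
      ((e (SemidirectProduct.inr (Ext.auto sigmaB3)) :
          Subgroup.normalizer (reflSubgroup uJ : Set WE7)) : WE7) = uσ := by
  have hsemi := isSemidirect_normalizer_J.map (MulAut.conj u)
  rw [← normalizer_reflSubgroup_uJ, map_conj_reflSubgroup_J, ← setStabilizer_uJ] at hsemi
  refine ⟨⟨image_u_J, ?_⟩, reflSubgroup_uJ, normalizer_reflSubgroup_uJ, hsemi, ?_, ?_⟩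
  · rw [← range_rootUJ]
    rintro _ ⟨k, rfl⟩
    exact rootUJ_mem_roots k
  · have h := isSemidirect_setStabilizer_J.map (MulAut.conj u)
    rw [← setStabilizer_uJ, map_conj_closure_range, MonoidHom.map_zpowers] at h
    exact h
  -- The embeddings for `J`, followed by conjugation by `u`, have as ranges the two factors of the
  -- normalizer, so the internal decomposition becomes the external one.
  · have hA : ((MulAut.conj u).toMonoidHom.comp sJHom).range = reflSubgroup uJ := by
      rw [MonoidHom.range_comp, sJHom_range, map_conj_reflSubgroup_J]
    have hC : ((MulAut.conj u).toMonoidHom.comp extHom).range = setStabilizer uJ := by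
      rw [MonoidHom.range_comp, extHom_range, setStabilizer_uJ]
    obtain ⟨φ, e, h1, h2⟩ := SemidirectProduct.exists_mulEquiv_of_injective
      ((MulAut.conj u).toMonoidHom.comp sJHom) ((MulAut.conj u).toMonoidHom.comp extHom)
      ((MulAut.conj u).injective.comp sJHom_injective)
      ((MulAut.conj u).injective.comp extHom_injective)
      (Subgroup.normalizer (reflSubgroup uJ : Set WE7)) (by rw [hA])
      (by rw [hA, hC]; exact hsemi.disjoint) (by rw [hA, hC]; exact hsemi.sup_eq)
    refine ⟨φ, e, fun i => ?_, fun i => ?_, ?_⟩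
    · rw [h1, ← conj_u_sJ, ← sJHom_simple]
      rfl
    · rw [h2, ub, ← extHom_s]
      rfl
    · rw [h2, uσ, ← extHom_auto]
      rfl
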